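/- Let $n\ge 3$. A spherically symmetric initial data set $(M,g,k)$ consists of $M=\{x\in\mathbb R^n:|x|\ge r_0\}$ with $r_0\ge 0$ (so $M=\mathbb R^n$ if $r_0=0$, and $\partial M=\{|x|=r_0\}$ if $r_0>0$), a Riemannian metric $g$ and a symmetric 2-tensor $k$, both smooth up to the boundary, such that for radial functions $g_{11},\rho,k_n,k_t$ of $r=|x|$ $$g=g_{11}\,dr^2+\rho^2 g_{S^{n-1}},\qquad k=k_n\,g_{11}\,dr^2+k_t\,\rho^2 g_{S^{n-1}}.$$ Let $\mu,J$ be given by $16\pi\mu=R_g+(\mathrm{Tr}_gk)^2-|k|_g^2$ and $8\pi J=\mathrm{div}_g(k-(\mathrm{Tr}_gk)g)$; the dominant energy condition is $\mu\ge|J|_g$. The data are asymptotically flat with constants $\rho_0\ge r_0$ and $C$ if for $|x|>\rho_0$, in the coordinates $x$, $$|\partial^{\beta}(g_{ij}-\delta_{ij})|\le \frac{C}{|x|^{n-2+|\beta|}}\ (|\beta|\le 2),\quad |\partial^{\beta}k_{ij}|\le\frac{C}{|x|^{n-1+|\beta|}}\ (|\beta|\le1),\quad |R_g|\le\frac{C}{|x|^{n+1}},\quad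 |\mathrm{Tr}_gk|\le\frac{C}{|x|^{n}}.$$ A sequence is uniformly asymptotically flat if $\rho_0$ and $C$ do not depend on the index. The ADM mass is $m=\sqrt{E^2-|P|^2}$ with $$E=\tfrac{1}{2(n-1)\omega_{n-1}}\lim_{r\to\infty}\int_{S_r}(g_{ij,i}-g_{ii,j})\nu^j,\qquad P_i=\tfrac{1}{2(n-1)\omega_{n-1}}\lim_{r\to\infty}\int_{S_r}(k_{ij}-(\mathrm{Tr}_gk)g_{ij})\nu^j,$$ where $\omega_{n-1}$ is the volume of the unit sphere $S^{n-1}$. The null expansions of the symmetry spheres $S_r$ are $\theta_\pm=(n-1)\big(\tfrac{\rho_r}{\sqrt{g_{11}}\,\rho}\pm k_t\big)$, and $S_r$ is a future (past) apparent horizon if $\theta_+(r)=0$ ($\theta_-(r)=0$). We say that the data have outermost apparent horizon boundary or no boundary if $S_{r_0}$ is an apparent horizon whenever $r_0>0$, and no $S_r$ with $r>r_0$ is an apparent horizon. Let $\bar M$ be $M$ without its boundary. For $f\in C^\infty(\bar M)$ put $\bar g=g+df^2$ and $h=\nabla_g^2f/\sqrt{1+|\nabla f|_g^2}$. Call $f$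 a Jang solution for $(M,g,k)$ if it is radial, satisfies Jang's equation $\mathrm{Tr}_{\bar g}(h-k)=0$ on $\bar M$, tends to $0$ at infinity and, if $r_0>0$, tends to $+\infty$ at $\partial M$, where $\partial M$ is a future apparent horizon, or to $-\infty$ at $\partial M$, where $\partial M$ is a past apparent horizon. For $A>0$ let $\rho_A$ be defined by $A=\omega_{n-1}\rho_A^{n-1}$, let $\Sigma_A=\{\rho=\rho_A\}$ and $\Omega_A=\{\rho\le\rho_A\}$ in $\bar M$, and let $T_D(\Sigma_A)$ be the set of points of $\bar M$ at $\bar g$-distance less than $D$ from some point of $\Sigma_A$. **Theorem.** Let $(M_j,g_j,k_j)$, $j\in\mathbb N$, be a sequence of $n$-dimensional, spherically symmetric, uniformly asymptotically flat initial data sets satisfying the dominant energy condition and with either outermost apparent horizon boundary or no boundary. Assume that $\|k_j\|_{L^2(M_j,g_j)}\le B$ for all $j$, with a constant $B$ independent of $j$, and that the ADM masses satisfy $m_j\to0$. Let $f_j$ be a Jang solution for $(M_j,g_j,k_j)$, with Jang metric $\bar g_j$ and second fundamental form $h_j$. Then for all $1\le p<2$, $A>0$ and $D>0$, $$\|h_j-k_j\|_{L^p(\Omega_A^j\cap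 T_D(\Sigma_A^j),\,\bar g_j)}\longrightarrow 0\qquad\text{as } j\to\infty .$$ -/

import Mathlib

open MeasureTheory Filter Topology
open scoped ENNReal ContDiff

noncomputable section

/-- Euclidean space `ℝⁿ`. -/
abbrev Space (n : ℕ) : Type := EuclideanSpace ℝ (Fin n)

/-- A field of 2-tensors, given by its components in the Cartesian coordinates of `ℝⁿ`. -/
abbrev TensorField (n : ℕ) : Type := Space n → Matrix (Fin n) (Fin n) ℝ

/-! ### Riemannian geometry in Cartesian coordinates -/

namespace Riem

variable {n : ℕ}

/-- The partial derivative `∂ᵢF`. -/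
def pd (i : Fin n) (F : Space n → ℝ) (x : Space n) : ℝ :=
  fderiv ℝ F x (EuclideanSpace.single i 1)

/-- The Christoffel symbol `Γᵐᵢⱼ = ½ gᵐˡ (∂ᵢ gⱼₗ + ∂ⱼ gᵢₗ - ∂ₗ gᵢⱼ)`. -/
def christoffel (g : TensorField n) (m i j : Fin n) (x : Space n) : ℝ :=
  (1 / 2) * ∑ l, (g x)⁻¹ m l *
    (pd i (fun y => g y j l) x + pd j (fun y => g y i l) x - pd l (fun y => g y i j) x)

/-- The Ricci tensor `∂ₘ Γᵐᵢⱼ - ∂ⱼ Γᵐᵢₘ + Γᵐₘₗ Γˡᵢⱼ - Γᵐⱼₗ Γˡᵢₘ`. -/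
def ricci (g : TensorField n) (i j : Fin n) (x : Space n) : ℝ :=
  ∑ m, (pd m (christoffel g m i j) x - pd j (christoffel g m i m) x
    + ∑ l, (christoffel g m m l x * christoffel g l i j x
      - christoffel g m j l x * christoffel g l i m x))

/-- The scalar curvature `R_g = gⁱʲ Ricᵢⱼ`. -/
def scalarCurvature (g : TensorField n) (x : Space n) : ℝ :=
  ∑ i, ∑ j, (g x)⁻¹ i j * ricci g i j x

/-- The trace `gⁱʲ Tᵢⱼ`. -/
def tr (g T : TensorField n) (x : Space n) : ℝ :=
  ∑ i, ∑ j, (g x)⁻¹ i j * T x i j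

/-- The squared length `gⁱᵃ gʲᵇ Tᵢⱼ Tₐᵦ` of a 2-tensor. -/
def normSq (g T : TensorField n) (x : Space n) : ℝ :=
  ∑ i, ∑ j, ∑ a, ∑ b, (g x)⁻¹ i a * (g x)⁻¹ j b * T x i j * T x a b

/-- The squared length `gⁱʲ αᵢ αⱼ` of a covector. -/
def covectorNormSq (g : TensorField n) (α : Fin n → ℝ) (x : Space n) : ℝ :=
  ∑ i, ∑ j, (g x)⁻¹ i j * α i * α j

/-- The covariant derivative `∇ₗ Tᵢⱼ`. -/
def covDeriv (g T : TensorField n) (l i j : Fin n) (x : Space n) : ℝ :=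
  pd l (fun y => T y i j) x
    - ∑ m, (christoffel g m l i x * T x m j + christoffel g m l j x * T x i m)

/-- The divergence `(div_g T)ᵢ = gʲˡ ∇ₗ Tᵢⱼ` of a 2-tensor. -/
def divergence (g T : TensorField n) (i : Fin n) (x : Space n) : ℝ :=
  ∑ j, ∑ l, (g x)⁻¹ j l * covDeriv g T l i j x

/-- The covariant Hessian `∇ᵢⱼ f = ∂ᵢ∂ⱼ f - Γᵐᵢⱼ ∂ₘ f`. -/
def hessian (g : TensorField n) (f : Space n → ℝ) (i j : Fin n) (x : Space n) : ℝ :=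
  pd i (pd j f) x - ∑ m, christoffel g m i j x * pd m f x

/-- The density `√(det g)` of the Riemannian volume `dV_g` with respect to Lebesgue measure. -/
def volDensity (g : TensorField n) (x : Space n) : ℝ :=
  √((g x).det)

/-- `‖T‖_{L^p(S, g)} = (∫_S |T|_g^p dV_g)^{1/p}`, with values in `[0, ∞]`. -/
def lpNorm (g T : TensorField n) (S : Set (Space n)) (p : ℝ) : ℝ≥0∞ :=
  (∫⁻ x in S, ENNReal.ofReal (√(normSq g T x)) ^ p * ENNReal.ofReal (volDensity g x)) ^ (1 / p)

/-- The `g`-length of a curve parametrized by `[0, 1]`. -/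
def curveLength (g : TensorField n) (γ : ℝ → Space n) : ℝ≥0∞ :=
  ∫⁻ t in Set.Icc (0 : ℝ) 1,
    ENNReal.ofReal (√(∑ i, ∑ j, g (γ t) i j * (deriv γ t) i * (deriv γ t) j))

/-- The Riemannian distance of the domain `U` with the metric `g`: the infimum of the lengths
of `C¹` curves in `U` from `a` to `b`. -/
def dist (g : TensorField n) (U : Set (Space n)) (a b : Space n) : ℝ≥0∞ :=
  ⨅ (γ : ℝ → Space n) (_ : ContDiffOn ℝ 1 γ (Set.Icc 0 1))
    (_ : ∀ t ∈ Set.Icc (0 : ℝ) 1, γ t ∈ U) (_ : γ 0 = a) (_ : γ 1 = b), curveLength g γ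

/-- The tubular neighborhood `T_R(S)` in the Riemannian manifold `(U, g)`. -/
def tube (g : TensorField n) (U S : Set (Space n)) (R : ℝ) : Set (Space n) :=
  {a | a ∈ U ∧ ∃ b ∈ S, dist g U a b < ENNReal.ofReal R}

end Riem

/-! ### Initial data sets -/

/-- Initial data `(M, g, k)` on `M = {x ∈ ℝⁿ : r₀ ≤ |x|}`: all of `ℝⁿ` if `r₀ = 0`, and the
complement of an open ball, with boundary `|x| = r₀`, if `r₀ > 0`. -/
structure InitialData (n : ℕ) where
  r₀ : ℝ
  r₀_nonneg : 0 ≤ r₀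
  g : TensorField n
  k : TensorField n
  /-- `g` and `k` are smooth up to the boundary. -/
  g_smooth : ∀ i j, ContDiffOn ℝ ∞ (fun x => g x i j) {x | r₀ ≤ ‖x‖}
  k_smooth : ∀ i j, ContDiffOn ℝ ∞ (fun x => k x i j) {x | r₀ ≤ ‖x‖}
  g_posDef : ∀ x, r₀ ≤ ‖x‖ → (g x).PosDef
  k_symm : ∀ x, r₀ ≤ ‖x‖ → (k x).IsSymm

namespace InitialData

variable {n : ℕ} (D : InitialData n)

/-- The manifold `M`. -/
def carrier : Set (Space n) := {x | D.r₀ ≤ ‖x‖}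

/-- The manifold `M̄` underlying the Jang deformation: `M` without its boundary. -/
def inner : Set (Space n) := interior D.carrier

/-- The energy density: `16 π μ = R_g + (Tr_g k)² - |k|_g²`. -/
def energyDensity (x : Space n) : ℝ :=
  (Riem.scalarCurvature D.g x + Riem.tr D.g D.k x ^ 2 - Riem.normSq D.g D.k x)
    / (16 * Real.pi)

/-- The momentum tensor `k - (Tr_g k) g`. -/
def momentumTensor : TensorField n :=
  fun x => D.k x - Riem.tr D.g D.k x • D.g x

/-- The momentum density: `8 π J = div_g (k - (Tr_g k) g)`. -/
def momentumDensity (x : Space n) (i : Fin n) : ℝ :=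
  Riem.divergence D.g D.momentumTensor i x / (8 * Real.pi)

/-- The dominant energy condition `|J|_g ≤ μ`. It is imposed at interior points; by continuity
it then holds up to the boundary. -/
def DominantEnergy : Prop :=
  ∀ x ∈ D.inner,
    √(Riem.covectorNormSq D.g (D.momentumDensity x) x) ≤ D.energyDensity x

/-- Asymptotic flatness with radius `ρ₀` and constant `C`, in the Cartesian coordinates `x` of
the end `|x| > ρ₀`. -/
structure AsymptoticallyFlat (ρ₀ C : ℝ) : Prop where
  r₀_le : D.r₀ ≤ ρ₀
  g_decay₀ : ∀ x, ρ₀ < ‖x‖ → ∀ i j,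
    |D.g x i j - (1 : Matrix (Fin n) (Fin n) ℝ) i j| ≤ C / ‖x‖ ^ (n - 2)
  g_decay₁ : ∀ x, ρ₀ < ‖x‖ → ∀ i j a,
    |Riem.pd a (fun y => D.g y i j) x| ≤ C / ‖x‖ ^ (n - 2 + 1)
  g_decay₂ : ∀ x, ρ₀ < ‖x‖ → ∀ i j a b,
    |Riem.pd a (Riem.pd b (fun y => D.g y i j)) x| ≤ C / ‖x‖ ^ (n - 2 + 2)
  k_decay₀ : ∀ x, ρ₀ < ‖x‖ → ∀ i j, |D.k x i j| ≤ C / ‖x‖ ^ (n - 1)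
  k_decay₁ : ∀ x, ρ₀ < ‖x‖ → ∀ i j a,
    |Riem.pd a (fun y => D.k y i j) x| ≤ C / ‖x‖ ^ (n - 1 + 1)
  scalar_decay : ∀ x, ρ₀ < ‖x‖ → |Riem.scalarCurvature D.g x| ≤ C / ‖x‖ ^ (n + 1)
  trace_decay : ∀ x, ρ₀ < ‖x‖ → |Riem.tr D.g D.k x| ≤ C / ‖x‖ ^ n

end InitialData

/-- `ω_{n-1}`, the volume of the unit sphere `S^{n-1} ⊂ ℝⁿ`. -/
def sphereVolume (n : ℕ) : ℝ :=
  ((volume : Measure (Space n)).toSphere Set.univ).toReal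

/-- The integral of `F` over the coordinate sphere `|x| = r` against its surface measure. -/
def sphereIntegral {n : ℕ} (F : Space n → ℝ) (r : ℝ) : ℝ :=
  r ^ (n - 1) * ∫ ν : Metric.sphere (0 : Space n) 1,
    F (r • (ν : Space n)) ∂(volume : Measure (Space n)).toSphere

namespace InitialData

variable {n : ℕ} (D : InitialData n)

/-- `(2(n-1)ω_{n-1})⁻¹ ∫_{S_r} (∂ᵢgᵢⱼ - ∂ⱼgᵢᵢ) νʲ`. -/
def energyFlux (r : ℝ) : ℝ :=
  1 / (2 * ((n : ℝ) - 1) * sphereVolume n) * sphereIntegral (fun x =>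
    ∑ i, ∑ j, (Riem.pd i (fun y => D.g y i j) x - Riem.pd j (fun y => D.g y i i) x)
      * (x j / ‖x‖)) r

/-- `(2(n-1)ω_{n-1})⁻¹ ∫_{S_r} (kᵢⱼ - (Tr_g k) gᵢⱼ) νʲ`. -/
def momentumFlux (i : Fin n) (r : ℝ) : ℝ :=
  1 / (2 * ((n : ℝ) - 1) * sphereVolume n) * sphereIntegral (fun x =>
    ∑ j, D.momentumTensor x i j * (x j / ‖x‖)) r

/-- `m` is the ADM mass `√(E² - |P|²)`; the limits defining `E` and `P` are required to exist. -/
def HasADMMass (m : ℝ) : Prop :=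
  ∃ (E : ℝ) (P : Fin n → ℝ), Tendsto D.energyFlux atTop (𝓝 E) ∧
    (∀ i, Tendsto (D.momentumFlux i) atTop (𝓝 (P i))) ∧ m = √(E ^ 2 - ∑ i, P i ^ 2)

/-! ### The Jang graph -/

/-- The Jang metric `ḡ = g + df²`. -/
def jangMetric (f : Space n → ℝ) : TensorField n :=
  fun x => Matrix.of fun i j => D.g x i j + Riem.pd i f x * Riem.pd j f x

/-- The second fundamental form `h = ∇²_g f / √(1 + |∇f|_g²)` of the graph of `f`. -/
def graphSecondForm (f : Space n → ℝ) : TensorField n :=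
  fun x => Matrix.of fun i j => Riem.hessian D.g f i j x
    / √(1 + Riem.covectorNormSq D.g (fun a => Riem.pd a f x) x)

/-- The difference `h - k` of second fundamental forms. -/
def secondFormDiff (f : Space n → ℝ) : TensorField n :=
  fun x => D.graphSecondForm f x - D.k x

end InitialData

/-! ### Spherical symmetry -/

/-- Spherically symmetric initial data:
`g = g₁₁(r) dr² + ρ(r)² g_{S^{n-1}}` and `k = kₙ(r) g₁₁(r) dr² + kₜ(r) ρ(r)² g_{S^{n-1}}`
with `r = |x|`. In Cartesian components `dr = xᵢ dxᵢ / r` and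
`g_{S^{n-1}} = (δᵢⱼ - xᵢ xⱼ / r²) dxᵢ dxⱼ / r²`. -/
structure SphericalData (n : ℕ) extends InitialData n where
  g₁₁ : ℝ → ℝ
  rho : ℝ → ℝ
  kn : ℝ → ℝ
  kt : ℝ → ℝ
  rho_pos : ∀ r, r₀ ≤ r → 0 < r → 0 < rho r
  rho_zero : r₀ = 0 → rho 0 = 0
  g_eq : ∀ x, r₀ ≤ ‖x‖ → x ≠ 0 → ∀ i j,
    g x i j = g₁₁ ‖x‖ * (x i / ‖x‖ * (x j / ‖x‖))
      + (rho ‖x‖ / ‖x‖) ^ 2 *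
        ((1 : Matrix (Fin n) (Fin n) ℝ) i j - x i / ‖x‖ * (x j / ‖x‖))
  k_eq : ∀ x, r₀ ≤ ‖x‖ → x ≠ 0 → ∀ i j,
    k x i j = kn ‖x‖ * g₁₁ ‖x‖ * (x i / ‖x‖ * (x j / ‖x‖))
      + kt ‖x‖ * (rho ‖x‖ / ‖x‖) ^ 2 *
        ((1 : Matrix (Fin n) (Fin n) ℝ) i j - x i / ‖x‖ * (x j / ‖x‖))

namespace SphericalData

variable {n : ℕ} (D : SphericalData n)

/-- The mean curvature `H = (n-1) ρ'(r) / (√g₁₁ ρ)` of the symmetry sphere `S_r` with respect to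
the normal pointing to infinity; the derivative is one-sided at the boundary `r = r₀`. -/
def meanCurvature (r : ℝ) : ℝ :=
  ((n : ℝ) - 1) * (derivWithin D.rho (Set.Ici D.r₀) r / (√(D.g₁₁ r) * D.rho r))

/-- The null expansion `θ₊ = H + Tr_{S_r} k`. -/
def thetaPlus (r : ℝ) : ℝ := D.meanCurvature r + ((n : ℝ) - 1) * D.kt r

/-- The null expansion `θ₋ = H - Tr_{S_r} k`. -/
def thetaMinus (r : ℝ) : ℝ := D.meanCurvature r - ((n : ℝ) - 1) * D.kt r

/-- Either there is no boundary, or the boundary is an apparent horizon; and no other symmetry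
sphere is an apparent horizon. -/
def OutermostHorizonOrNoBoundary : Prop :=
  (0 < D.r₀ → D.thetaPlus D.r₀ = 0 ∨ D.thetaMinus D.r₀ = 0) ∧
    ∀ r, D.r₀ < r → D.thetaPlus r ≠ 0 ∧ D.thetaMinus r ≠ 0

/-- `f` is the spherically symmetric solution of Jang's equation `Tr_ḡ (h - k) = 0` that
vanishes at infinity and blows up to `+∞` (to `-∞`) at a future (past) horizon boundary. -/
structure IsJangSolution (f : Space n → ℝ) : Prop where
  smooth : ContDiffOn ℝ ∞ f D.inner
  radial : ∃ φ : ℝ → ℝ, ∀ x ∈ D.inner, f x = φ ‖x‖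
  jang : ∀ x ∈ D.inner, Riem.tr (D.jangMetric f) (D.secondFormDiff f) x = 0
  decay : Tendsto f (comap norm atTop) (𝓝 0)
  blowUp : 0 < D.r₀ →
    (D.thetaPlus D.r₀ = 0 ∧ Tendsto f (comap norm (𝓝[>] D.r₀)) atTop) ∨
    (D.thetaMinus D.r₀ = 0 ∧ Tendsto f (comap norm (𝓝[>] D.r₀)) atBot)

/-- The radius `ρ_A` determined by `A = ω_{n-1} ρ_A^{n-1}`. -/
def areaRadius (n : ℕ) (A : ℝ) : ℝ := (A / sphereVolume n) ^ (1 / ((n : ℝ) - 1))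

/-- The symmetry sphere `Σ_A = ρ⁻¹(ρ_A)` of area `A`, in `M̄`. -/
def levelSphere (A : ℝ) : Set (Space n) := {x | x ∈ D.inner ∧ D.rho ‖x‖ = areaRadius n A}

/-- The region `Ω_A = ρ⁻¹[0, ρ_A]`, in `M̄`. -/
def region (A : ℝ) : Set (Space n) := {x | x ∈ D.inner ∧ D.rho ‖x‖ ≤ areaRadius n A}

/-- `Ω_A ∩ T_R(Σ_A)`, the tubular neighborhood being taken in the Jang deformation `(M̄, ḡ)`. -/
def tubularRegion (f : Space n → ℝ) (A R : ℝ) : Set (Space n) :=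
  D.region A ∩ Riem.tube (D.jangMetric f) D.inner (D.levelSphere A) R

end SphericalData

end

/-! Everything reduces to functions of `r`. Put `s = √g₁₁`, `X = ρ'/s`, `Y = ρ kₜ`, and let `v =
φ'/√(g₁₁ + φ'²)` be the slope of the Jang graph `f = φ(|x|)`. Jang's equation makes the radial
eigenvalue of `h - k` with respect to `ḡ` equal to `-(n-1)` times the tangential one, so `|h - k|² =
n(n-1) (G/ρ)²` with the defect `G = X v - Y`. The task is to bound `G` by the mass.

The first ingredient is the Misner–Sharp mass `M = ½ ρⁿ⁻² (1 - X² + Y²)`. Outside the outermost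
horizon `|Y| < X`, so the dominant energy condition makes `M` nondecreasing. It is nonnegative at
the center or the horizon and tends to the energy `E` at infinity; the momentum vanishes by
symmetry, so `0 ≤ M ≤ |E| = m` (`misnerSharp_mem_Icc`, `tendsto_misnerSharp`).

The second ingredient is the boosted expansion `H = (X - Y v)/√(1 - v²)`. The constraints and Jang's
equation give the Riccati inequality `H' ≤ σ (n-1)(1 - H²)/ρ`, where `σ = √(g₁₁ + φ'²)` is the
radial length density of `ḡ`. If `H > 1` somewhere, `H` would have to blow up at finite `∫ σ/ρ`
further in. But that integral diverges at the inner end: at a center because `ρ` is at most a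
multiple of `r`, at a horizon because `f` blows up. Hence `H ≤ 1` (`boosted_le_one`,
`exists_divergent_primitive`).

The identity `H² = G²/(1 - v²) + X² - Y²` now gives `G² ≤ 1 - X² + Y² = 2M/ρⁿ⁻²`, so `G² ≤ min 1
(2m/ρⁿ⁻²)` (`sq_defect_le`).

Finally, the volume element of `ḡ` in polar coordinates is `ρⁿ⁻¹ σ dr` times that of the unit
sphere. For `1 ≤ p < 2`, the bound on `G` makes `|G/ρ|ᵖ ρⁿ⁻¹` at most a constant times `m^((2-p)/2)`
where `ρ ≤ ρ_A` (`rpow_defect_le`). What remains is `∫ σ dr` over the radii met by the tube, which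
is at most its width because no curve is shorter than its radial part
(`lintegral_Icc_le_curveLength`). -/

noncomputable section

/-! ### The constraint equations and Jang's equation as radial differential equations -/

/-- The constraint equations in spherical symmetry outside the outermost horizon, with
`X = ρ' / √g₁₁`, `Y = ρ kₜ`, `s = √g₁₁` and rescaled energy and momentum densities `μ`, `J`. -/
structure SphericalConstraints (n : ℕ) (r₀ : ℝ) (s ρ X Y kn μ J : ℝ → ℝ) : Prop where
  s_pos : ∀ r, r₀ < r → 0 < s r
  rho_pos : ∀ r, r₀ < r → 0 < ρ r
  hasDerivAt_rho : ∀ r, r₀ < r → HasDerivAt ρ (s r * X r) r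
  hasDerivAt_X : ∀ r, r₀ < r → HasDerivAt X
    (s r * (Y r * kn r + ((n : ℝ) - 2) * (1 - X r ^ 2 + Y r ^ 2) / (2 * ρ r) - ρ r * μ r)) r
  hasDerivAt_Y : ∀ r, r₀ < r → HasDerivAt Y (s r * (X r * kn r - ρ r * J r)) r
  abs_J_le : ∀ r, r₀ < r → |J r| ≤ μ r
  abs_Y_lt : ∀ r, r₀ < r → |Y r| < X r

/-- The Misner–Sharp mass `½ ρⁿ⁻² (1 - X² + Y²)`. -/
def misnerSharp (n : ℕ) (ρ X Y : ℝ → ℝ) (r : ℝ) : ℝ :=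
  ρ r ^ (n - 2) * (1 - X r ^ 2 + Y r ^ 2) / 2

namespace SphericalConstraints

variable {n : ℕ} {r₀ : ℝ} {s ρ X Y kn μ J : ℝ → ℝ}

/-- The `kₙ` contributions of `-X X'` and `Y Y'` cancel, and the term of `X'` containing `1 - X² +
Y²` cancels the derivative of `ρⁿ⁻²`; only the matter terms survive. -/
theorem hasDerivAt_misnerSharp (h : SphericalConstraints n r₀ s ρ X Y kn μ J) (hn : 3 ≤ n)
    {r : ℝ} (hr : r₀ < r) :
    HasDerivAt (misnerSharp n ρ X Y) (s r * ρ r ^ (n - 1) * (μ r * X r - J r * Y r)) r := by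
  obtain ⟨j, rfl⟩ : ∃ j, n = j + 3 := ⟨n - 3, by omega⟩
  have h1 := (((h.hasDerivAt_rho r hr).pow (j + 1)).mul
    ((((h.hasDerivAt_X r hr).pow 2).const_sub 1).add ((h.hasDerivAt_Y r hr).pow 2))).div_const 2
  have hρ := (h.rho_pos r hr).ne'
  refine h1.congr_deriv ?_
  simp only [Pi.pow_apply, Pi.add_apply, Nat.add_sub_cancel, show j + 3 - 1 = j + 2 by omega]
  push_cast
  field_simp
  ring

/-- Since `|J| ≤ μ` and `|Y| < X`, the matter term `μ X - J Y` is nonnegative. -/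
theorem monotoneOn_misnerSharp (h : SphericalConstraints n r₀ s ρ X Y kn μ J) (hn : 3 ≤ n) :
    MonotoneOn (misnerSharp n ρ X Y) (Set.Ioi r₀) := by
  refine monotoneOn_of_deriv_nonneg (convex_Ioi r₀)
    (fun r hr => (h.hasDerivAt_misnerSharp hn hr).continuousAt.continuousWithinAt)
    (fun r hr => ?_) (fun r hr => ?_) <;> rw [interior_Ioi] at hr
  · exact (h.hasDerivAt_misnerSharp hn hr).differentiableAt.differentiableWithinAt
  · rw [(h.hasDerivAt_misnerSharp hn hr).deriv]
    have hs := h.s_pos r hr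
    have hρ := h.rho_pos r hr
    have h1 : J r * Y r ≤ μ r * X r := (le_abs_self _).trans <| by
      rw [abs_mul]
      exact mul_le_mul (h.abs_J_le r hr) (h.abs_Y_lt r hr).le (abs_nonneg _)
        ((abs_nonneg _).trans (h.abs_J_le r hr))
    have := sub_nonneg.2 h1
    positivity

/-- The Misner–Sharp mass lies between `0` and its limit at infinity. -/
theorem misnerSharp_mem_Icc (h : SphericalConstraints n r₀ s ρ X Y kn μ J) (hn : 3 ≤ n) {E : ℝ}
    (h0 : ∃ L : ℝ → ℝ, (∀ᶠ r in 𝓝[>] r₀, L r ≤ misnerSharp n ρ X Y r) ∧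
      Tendsto L (𝓝[>] r₀) (𝓝 0))
    (hE : Tendsto (misnerSharp n ρ X Y) atTop (𝓝 E)) {r : ℝ} (hr : r₀ < r) :
    misnerSharp n ρ X Y r ∈ Set.Icc 0 E := by
  have hmono := h.monotoneOn_misnerSharp hn
  obtain ⟨L, hL, hL0⟩ := h0
  constructor
  · refine le_of_tendsto hL0 ?_
    filter_upwards [hL, Ioo_mem_nhdsGT hr] with t ht ht'
    exact ht.trans (hmono ht'.1 hr ht'.2.le)
  · refine ge_of_tendsto hE ?_
    filter_upwards [eventually_ge_atTop r] with t ht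
    exact hmono hr (hr.trans_le ht) ht

/-! ### The boosted expansion and its Riccati inequality -/

variable {v : ℝ → ℝ}

/-- The boosted expansion `(X - Y v) / √(1 - v²)`. -/
def boosted (X Y v : ℝ → ℝ) (r : ℝ) : ℝ := (X r - Y r * v r) / √(1 - v r ^ 2)

/-- Positivity is what allows the bound `H ≤ 1` to be squared in `defect_le`. -/
theorem boosted_pos (h : SphericalConstraints n r₀ s ρ X Y kn μ J) {r : ℝ} (hr : r₀ < r)
    (hv : |v r| < 1) : 0 < boosted X Y v r := by
  have h1 : 0 < 1 - v r ^ 2 := by rw [← sq_abs]; nlinarith [abs_nonneg (v r)]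
  refine div_pos ?_ (Real.sqrt_pos.2 h1)
  have h2 : Y r * v r ≤ |Y r| * |v r| := (le_abs_self _).trans (abs_mul _ _).le
  have h3 : |Y r| * |v r| ≤ |Y r| := mul_le_of_le_one_right (abs_nonneg _) hv.le
  linarith [h.abs_Y_lt r hr]

/-- Lorentz invariance in the plane: `(X - Y v)² - (X v - Y)² = (1 - v²)(X² - Y²)`. -/
theorem boosted_sq {X Y v : ℝ → ℝ} {r : ℝ} (hv : |v r| < 1) :
    boosted X Y v r ^ 2 = (X r * v r - Y r) ^ 2 / (1 - v r ^ 2) + X r ^ 2 - Y r ^ 2 := by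
  have h1 : 0 < 1 - v r ^ 2 := by rw [← sq_abs]; nlinarith [abs_nonneg (v r)]
  rw [boosted, div_pow, Real.sq_sqrt h1.le]
  field_simp
  ring

/-- The hypothesis that `v` solves Jang's equation. -/
def JangODE (n : ℕ) (r₀ : ℝ) (s ρ X Y kn v : ℝ → ℝ) : Prop :=
  ∀ r, r₀ < r → |v r| < 1 ∧ HasDerivAt v
    (s r * ((1 - v r ^ 2) * kn r - ((n : ℝ) - 1) * (X r * v r - Y r) / ρ r)) r

/-- The derivative is computed exactly: `kₙ` drops out, and what separates it from the upper bound
is a multiple of `n (1 - X² + Y²)/(2ρ) + ρ (μ - J v)`. The first summand is nonnegative because the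
Misner–Sharp mass is, the second because `|J| ≤ μ` and `|v| < 1`. -/
theorem exists_hasDerivAt_boosted (h : SphericalConstraints n r₀ s ρ X Y kn μ J) (hn : 3 ≤ n)
    (hv : JangODE n r₀ s ρ X Y kn v) {r : ℝ} (hr : r₀ < r) (hM : 0 ≤ misnerSharp n ρ X Y r) :
    ∃ d, HasDerivAt (boosted X Y v) d r ∧
      d ≤ s r / √(1 - v r ^ 2) * (((n : ℝ) - 1) * (1 - boosted X Y v r ^ 2) / ρ r) := by
  obtain ⟨hv1, hv'⟩ := hv r hr
  have h1 : 0 < 1 - v r ^ 2 := by rw [← sq_abs]; nlinarith [abs_nonneg (v r)]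
  have hρ := h.rho_pos r hr
  have hs := h.s_pos r hr
  have hn' : (3 : ℝ) ≤ n := by exact_mod_cast hn
  have hq := Real.sqrt_pos.2 h1
  have hsq := Real.sq_sqrt h1.le
  have h2 := ((h.hasDerivAt_X r hr).sub ((h.hasDerivAt_Y r hr).mul hv')).div
    (((hv'.pow 2).const_sub 1).sqrt h1.ne') hq.ne'
  refine ⟨_, h2, ?_⟩
  rw [boosted_sq hv1]
  have hM' : 0 ≤ 1 - X r ^ 2 + Y r ^ 2 := by
    rw [misnerSharp] at hM
    have : 0 < ρ r ^ (n - 2) := by positivity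
    by_contra hc
    nlinarith [mul_neg_of_pos_of_neg this (not_le.1 hc)]
  have hJ : 0 ≤ μ r - J r * v r := by
    have : J r * v r ≤ |J r| * |v r| := (le_abs_self _).trans (abs_mul _ _).le
    have h3 : |J r| * |v r| ≤ |J r| := mul_le_of_le_one_right (abs_nonneg _) hv1.le
    linarith [h.abs_J_le r hr]
  set q := √(1 - v r ^ 2) with hqdef
  have key : ((s r * (Y r * kn r + ((n : ℝ) - 2) * (1 - X r ^ 2 + Y r ^ 2) / (2 * ρ r) - ρ r * μ r)
      - (s r * (X r * kn r - ρ r * J r) * v r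
        + Y r * (s r * ((1 - v r ^ 2) * kn r - ((n : ℝ) - 1) * (X r * v r - Y r) / ρ r)))) * q
      - (X r - Y r * v r) * (-(2 * v r *
        (s r * ((1 - v r ^ 2) * kn r - ((n : ℝ) - 1) * (X r * v r - Y r) / ρ r))) / (2 * q))) / q ^ 2
      = s r / q * (((n : ℝ) - 1) * (1 - ((X r * v r - Y r) ^ 2 / (1 - v r ^ 2) + X r ^ 2 - Y r ^ 2))
        / ρ r) - s r / q * ((n : ℝ) * (1 - X r ^ 2 + Y r ^ 2) / (2 * ρ r)
          + ρ r * (μ r - J r * v r)) := by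
    rw [← hsq]
    field_simp
    rw [hsq]
    ring
  have h5 : 0 ≤ s r / q * ((n : ℝ) * (1 - X r ^ 2 + Y r ^ 2) / (2 * ρ r)
      + ρ r * (μ r - J r * v r)) := by positivity
  refine le_trans (le_of_eq ?_) (key.trans_le (sub_le_self _ h5))
  simp only [Pi.sub_apply, Pi.mul_apply, Pi.pow_apply]
  push_cast
  ring

/-- If the boundary is infinitely far away in the sense that `∫ γ s / ρ` diverges, the boosted
expansion is at most its value `1` in Minkowski space. -/
theorem boosted_le_one (h : SphericalConstraints n r₀ s ρ X Y kn μ J) (hn : 3 ≤ n)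
    (hv : JangODE n r₀ s ρ X Y kn v) (hM : ∀ r, r₀ < r → 0 ≤ misnerSharp n ρ X Y r)
    {W w : ℝ → ℝ} (hW : ∀ᶠ r in 𝓝[>] r₀, HasDerivAt W (w r) r ∧
      w r ≤ s r / √(1 - v r ^ 2) * (((n : ℝ) - 1) / ρ r))
    (hW' : Tendsto W (𝓝[>] r₀) atBot) {r₁ : ℝ} (hr₁ : r₀ < r₁) : boosted X Y v r₁ ≤ 1 := by
  by_contra! hc
  set H := boosted X Y v with hH
  have hn' : (3 : ℝ) ≤ n := by exact_mod_cast hn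
  choose! H' hH' hle using fun r hr => h.exists_hasDerivAt_boosted hn hv hr (hM r hr)
  have hσ : ∀ r, r₀ < r → 0 < s r / √(1 - v r ^ 2) * (((n : ℝ) - 1) / ρ r) := by
    intro r hr
    have h1 : 0 < 1 - v r ^ 2 := by
      rw [← sq_abs]; nlinarith [abs_nonneg (v r), (hv r hr).1]
    have := h.s_pos r hr
    have := h.rho_pos r hr
    have : (0 : ℝ) < n - 1 := by linarith
    positivity
  have hle' : ∀ r, r₀ < r →
      H' r ≤ -(s r / √(1 - v r ^ 2) * (((n : ℝ) - 1) / ρ r) * (H r ^ 2 - 1)) := by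
    intro r hr
    refine (hle r hr).trans_eq ?_
    ring
  -- Where `H` equals a level `b > 1`, the Riccati inequality forces `H' < 0`, so `H` cannot climb
  -- through `b` as `r` increases. Hence moving inward from `r₁` keeps `H` at or above `H r₁ > 1`.
  have hge : ∀ r, r₀ < r → r ≤ r₁ → H r₁ ≤ H r := by
    intro r hr hrr
    by_contra! hlt
    obtain ⟨b, hb1, hb2⟩ := exists_between (max_lt hlt hc)
    have := image_le_of_deriv_right_lt_deriv_boundary (f := H) (f' := H') (a := r) (b := r₁)
      (fun x hx => (hH' x (hr.trans_le hx.1)).continuousAt.continuousWithinAt)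
      (fun x hx => (hH' x (hr.trans_le hx.1)).hasDerivWithinAt)
      (B := fun _ => b) (B' := fun _ => 0) ((le_max_left _ _).trans hb1.le)
      (fun x => hasDerivAt_const x b) (fun x hx hxb => by
        refine (hle' x (hr.trans_le hx.1)).trans_lt ?_
        have hb : 1 < b := (le_max_right _ _).trans_lt hb1
        have : 0 < H x ^ 2 - 1 := by rw [hxb]; nlinarith
        have := mul_pos (hσ x (hr.trans_le hx.1)) this
        linarith) (Set.right_mem_Icc.2 hrr)
    linarith
  obtain ⟨u, hu, huW⟩ := mem_nhdsGT_iff_exists_Ioo_subset.1 hW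
  -- `r₂` lies inside both the interval where `W` is controlled and the one where `H > 1`.
  set r₂ := (r₀ + min u r₁) / 2 with hr₂
  have hmin : r₀ < min u r₁ := lt_min hu hr₁
  have hr₂0 : r₀ < r₂ := by linarith
  have hr₂u : r₂ < u := by linarith [min_le_left u r₁]
  have hr₂1 : r₂ ≤ r₁ := by linarith [min_le_right u r₁]
  have hδ : ∀ r ∈ Set.Ioc r₀ r₂, 0 < H r - 1 := fun r hr => by
    linarith [hge r hr.1 (hr.2.trans hr₂1)]
  have hder : ∀ r ∈ Set.Ioc r₀ r₂, HasDerivAt (fun r => (H r - 1)⁻¹ - W r)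
      (-H' r / (H r - 1) ^ 2 - w r) r := fun r hr =>
    (((hH' r hr.1).sub_const 1).fun_inv (hδ r hr).ne').sub (huW ⟨hr.1, hr.2.trans_lt hr₂u⟩).1
  -- The derivative of `(H - 1)⁻¹` is `-H'/(H - 1)²`, and `-H'` is at least the weight times `H² - 1
  -- ≥ (H - 1)²`. So `(H - 1)⁻¹` grows at least as fast as `W`.
  have hmono : MonotoneOn (fun r => (H r - 1)⁻¹ - W r) (Set.Ioc r₀ r₂) := by
    refine monotoneOn_of_deriv_nonneg (convex_Ioc r₀ r₂)
      (fun r hr => (hder r hr).continuousAt.continuousWithinAt)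
      (fun r hr => (hder r (interior_subset hr)).differentiableAt.differentiableWithinAt)
      (fun r hr => ?_)
    have hr := interior_subset hr
    rw [(hder r hr).deriv, sub_nonneg]
    refine (huW ⟨hr.1, hr.2.trans_lt hr₂u⟩).2.trans ?_
    have hd := hδ r hr
    rw [le_div_iff₀ (by positivity)]
    have h1 := hle' r hr.1
    have h2 : s r / √(1 - v r ^ 2) * (((n : ℝ) - 1) / ρ r) * (H r - 1) ^ 2 ≤
        s r / √(1 - v r ^ 2) * (((n : ℝ) - 1) / ρ r) * (H r ^ 2 - 1) :=
      mul_le_mul_of_nonneg_left (by nlinarith) (hσ r hr.1).le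
    linarith
  -- Monotonicity and `(H - 1)⁻¹ > 0` bound `W` below near `r₀`, against its divergence to `-∞`.
  have hbdd : ∀ᶠ r in 𝓝[>] r₀, W r ≥ -((H r₂ - 1)⁻¹ - W r₂) := by
    filter_upwards [Ioo_mem_nhdsGT hr₂0] with r hr
    have h1 := hmono ⟨hr.1, hr.2.le⟩ ⟨hr₂0, le_rfl⟩ hr.2.le
    have h2 := inv_pos.2 (hδ r ⟨hr.1, hr.2.le⟩)
    simp only at h1
    linarith
  obtain ⟨r, hr, hr'⟩ :=
    (hbdd.and (hW'.eventually (eventually_lt_atBot (-((H r₂ - 1)⁻¹ - W r₂))))).exists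
  linarith

/-- The defect `(X v - Y)² / (1 - v²)` is controlled by the Misner–Sharp mass. -/
theorem defect_le (h : SphericalConstraints n r₀ s ρ X Y kn μ J)
    (hv : JangODE n r₀ s ρ X Y kn v) {r : ℝ} (hr : r₀ < r) (hle : boosted X Y v r ≤ 1) :
    (X r * v r - Y r) ^ 2 ≤ 1 - X r ^ 2 + Y r ^ 2 := by
  have hv1 := (hv r hr).1
  have h1 : 0 < 1 - v r ^ 2 := by rw [← sq_abs]; nlinarith [abs_nonneg (v r)]
  have h2 := boosted_sq (X := X) (Y := Y) hv1
  have h3 : boosted X Y v r ^ 2 ≤ 1 := by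
    have := (h.boosted_pos hr hv1).le
    nlinarith
  have h4 : (X r * v r - Y r) ^ 2 ≤ (X r * v r - Y r) ^ 2 / (1 - v r ^ 2) := by
    rw [le_div_iff₀ h1]
    nlinarith [mul_nonneg (sq_nonneg (X r * v r - Y r)) (sq_nonneg (v r))]
  linarith

end SphericalConstraints

/-! ### Partial derivatives of radial tensor fields -/

namespace Riem

variable {n : ℕ}

/-- The components `νᵢ = xᵢ / |x|` of the radial unit vector. -/
def nu (x : Space n) (i : Fin n) : ℝ := x i / ‖x‖

/-- The components `δᵢⱼ - νᵢ νⱼ` of the tangential projection. -/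
def tang (x : Space n) (i j : Fin n) : ℝ := (1 : Matrix (Fin n) (Fin n) ℝ) i j - nu x i * nu x j

theorem tang_comm (x : Space n) (i j : Fin n) : tang x i j = tang x j i := by
  simp only [tang, Matrix.one_apply, eq_comm (a := i), mul_comm (nu x i)]

theorem sum_nu_mul_nu {x : Space n} (hx : x ≠ 0) : ∑ i, nu x i * nu x i = 1 := by
  have h1 : ∑ i, nu x i * nu x i = (∑ i, x i ^ 2) / ‖x‖ ^ 2 := by
    rw [Finset.sum_div]; exact Finset.sum_congr rfl fun i _ => by simp only [nu]; ring
  rw [h1, ← EuclideanSpace.real_norm_sq_eq, div_self (pow_ne_zero 2 (norm_ne_zero_iff.2 hx))]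

theorem sum_tang_mul (x : Space n) (i : Fin n) (w : Fin n → ℝ) :
    ∑ j, tang x i j * w j = w i - nu x i * ∑ j, nu x j * w j := by
  simp [tang, sub_mul, Matrix.one_apply, Finset.sum_sub_distrib, Finset.mul_sum, mul_assoc]

theorem sum_tang_mul_nu {x : Space n} (hx : x ≠ 0) (i : Fin n) : ∑ j, tang x i j * nu x j = 0 := by
  rw [sum_tang_mul, sum_nu_mul_nu hx]; ring

theorem sum_tang_mul_nu' {x : Space n} (hx : x ≠ 0) (i : Fin n) :
    ∑ j, tang x j i * nu x j = 0 := by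
  simp_rw [tang_comm x _ i, sum_tang_mul_nu hx]

theorem sum_nu_mul_tang {x : Space n} (hx : x ≠ 0) (i : Fin n) :
    ∑ j, nu x j * tang x j i = 0 := by
  simp_rw [mul_comm (nu x _), sum_tang_mul_nu' hx]

theorem sum_tang_mul_tang {x : Space n} (hx : x ≠ 0) (i k : Fin n) :
    ∑ j, tang x i j * tang x j k = tang x i k := by
  rw [sum_tang_mul, sum_nu_mul_tang hx]; ring

theorem sum_tang {x : Space n} (hx : x ≠ 0) : ∑ i, tang x i i = (n : ℝ) - 1 := by
  simp [tang, Finset.sum_sub_distrib, sum_nu_mul_nu hx]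

/-- `F` is differentiable at `x` with partial derivatives `d`. -/
def HasPD (F : Space n → ℝ) (d : Fin n → ℝ) (x : Space n) : Prop :=
  DifferentiableAt ℝ F x ∧ ∀ l, pd l F x = d l

namespace HasPD

variable {F G : Space n → ℝ} {d e : Fin n → ℝ} {x : Space n}

theorem congr (h : HasPD F d x) (hd : ∀ l, d l = e l) : HasPD F e x :=
  ⟨h.1, fun l => (h.2 l).trans (hd l)⟩

theorem congr_of_eventuallyEq (h : HasPD F d x) (hG : G =ᶠ[𝓝 x] F) : HasPD G d x :=
  ⟨h.1.congr_of_eventuallyEq hG, fun l => by rw [pd, hG.fderiv_eq]; exact h.2 l⟩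

theorem const (c : ℝ) : HasPD (fun _ : Space n => c) (fun _ => 0) x :=
  ⟨differentiableAt_const c, fun l => by simp [pd]⟩

theorem add (hF : HasPD F d x) (hG : HasPD G e x) :
    HasPD (fun y => F y + G y) (fun l => d l + e l) x :=
  ⟨hF.1.add hG.1, fun l => by
    beta_reduce
    rw [← hF.2 l, ← hG.2 l, pd, fderiv_fun_add hF.1 hG.1]; rfl⟩

theorem sub (hF : HasPD F d x) (hG : HasPD G e x) :
    HasPD (fun y => F y - G y) (fun l => d l - e l) x :=
  ⟨hF.1.sub hG.1, fun l => by
    beta_reduce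
    rw [← hF.2 l, ← hG.2 l, pd, fderiv_fun_sub hF.1 hG.1]; rfl⟩

theorem mul (hF : HasPD F d x) (hG : HasPD G e x) :
    HasPD (fun y => F y * G y) (fun l => d l * G x + F x * e l) x :=
  ⟨hF.1.mul hG.1, fun l => by
    beta_reduce
    rw [← hF.2 l, ← hG.2 l, pd, fderiv_fun_mul hF.1 hG.1]
    simp [pd]; ring⟩

theorem coord (i : Fin n) :
    HasPD (fun y : Space n => y i) (fun l => (1 : Matrix (Fin n) (Fin n) ℝ) i l) x := by
  have h : HasFDerivAt (fun y : Space n => y i) (EuclideanSpace.proj i : Space n →L[ℝ] ℝ) x :=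
    (EuclideanSpace.proj i : Space n →L[ℝ] ℝ).hasFDerivAt
  refine ⟨h.differentiableAt, fun l => ?_⟩
  rw [pd, h.fderiv]
  simp [Matrix.one_apply]

end HasPD

variable {x : Space n}

theorem hasPD_norm (hx : x ≠ 0) : HasPD (fun y : Space n => ‖y‖) (nu x) x := by
  have h0 : ‖x‖ ≠ 0 := norm_ne_zero_iff.2 hx
  have h := (hasStrictFDerivAt_norm_sq x).hasFDerivAt.sqrt (pow_ne_zero 2 h0)
  simp only [Real.sqrt_sq (norm_nonneg _)] at h
  refine ⟨h.differentiableAt, fun l => ?_⟩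
  rw [pd, h.fderiv]
  simp [nu, EuclideanSpace.inner_single_right]
  field_simp

/-- The chain rule for a radial function. -/
theorem hasPD_radial {φ : ℝ → ℝ} {φ' : ℝ} (hφ : HasDerivAt φ φ' ‖x‖) (hx : x ≠ 0) :
    HasPD (fun y : Space n => φ ‖y‖) (fun l => φ' * nu x l) x := by
  have h := hφ.comp_hasFDerivAt x (hasPD_norm (n := n) hx).1.hasFDerivAt
  refine ⟨h.differentiableAt, fun l => ?_⟩
  beta_reduce
  rw [pd, HasFDerivAt.fderiv (f := fun y : Space n => φ ‖y‖) h, ← (hasPD_norm (n := n) hx).2 l]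
  simp [pd]

theorem hasPD_nu (hx : x ≠ 0) (i : Fin n) :
    HasPD (fun y : Space n => nu y i) (fun l => tang x i l / ‖x‖) x := by
  have h0 : ‖x‖ ≠ 0 := norm_ne_zero_iff.2 hx
  have h := (HasPD.coord (x := x) i).mul (hasPD_radial (hasDerivAt_inv h0) hx)
  refine (h.congr_of_eventuallyEq (.of_forall fun y => div_eq_mul_inv _ _)).congr fun l => ?_
  simp only [tang, nu]
  field_simp
  ring

theorem hasPD_tang (hx : x ≠ 0) (i j : Fin n) : HasPD (fun y : Space n => tang y i j)
    (fun l => -(tang x i l * nu x j + nu x i * tang x j l) / ‖x‖) x := by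
  refine ((HasPD.const _).sub ((hasPD_nu hx i).mul (hasPD_nu hx j))).congr fun l => ?_
  ring

/-- The matrix `N νᵢνⱼ + T (δᵢⱼ - νᵢνⱼ)`. -/
def radMat (N T : ℝ) (x : Space n) : Matrix (Fin n) (Fin n) ℝ :=
  Matrix.of fun i j => N * (nu x i * nu x j) + T * tang x i j

theorem radMat_apply (N T : ℝ) (x : Space n) (i j : Fin n) :
    radMat N T x i j = N * (nu x i * nu x j) + T * tang x i j := rfl

theorem radMat_comm (N T : ℝ) (x : Space n) (i j : Fin n) :
    radMat N T x i j = radMat N T x j i := by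
  rw [radMat_apply, radMat_apply, tang_comm, mul_comm (nu x i)]

theorem sum_radMat_mul_nu (hx : x ≠ 0) (N T : ℝ) (i : Fin n) :
    ∑ j, radMat N T x i j * nu x j = N * nu x i := by
  have : ∀ j, radMat N T x i j * nu x j =
      N * nu x i * (nu x j * nu x j) + T * (tang x i j * nu x j) := fun j => by
    rw [radMat_apply]; ring
  simp_rw [this, Finset.sum_add_distrib, ← Finset.mul_sum, sum_nu_mul_nu hx, sum_tang_mul_nu hx]
  ring

theorem sum_radMat_mul_tang (hx : x ≠ 0) (N T : ℝ) (i k : Fin n) :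
    ∑ j, radMat N T x i j * tang x j k = T * tang x i k := by
  have : ∀ j, radMat N T x i j * tang x j k =
      N * nu x i * (nu x j * tang x j k) + T * (tang x i j * tang x j k) := fun j => by
    rw [radMat_apply]; ring
  simp_rw [this, Finset.sum_add_distrib, ← Finset.mul_sum, sum_nu_mul_tang hx,
    sum_tang_mul_tang hx]
  ring

/-- `ν ⊗ ν` and the tangential projection are complementary orthogonal projections, so products,
inverses and traces can be read off the eigenvalues `N` (once) and `T` (`n - 1` times). -/
theorem radMat_mul (hx : x ≠ 0) (N T N' T' : ℝ) :
    radMat N T x * radMat N' T' x = radMat (N * N') (T * T') x := by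
  ext i k
  have : ∀ j, radMat N T x i j * radMat N' T' x j k =
      N' * nu x k * (radMat N T x i j * nu x j) + T' * (radMat N T x i j * tang x j k) := fun j => by
    rw [radMat_apply N' T']; ring
  simp_rw [Matrix.mul_apply, this, Finset.sum_add_distrib, ← Finset.mul_sum,
    sum_radMat_mul_nu hx, sum_radMat_mul_tang hx]
  rw [radMat_apply]; ring

theorem radMat_one (x : Space n) : radMat 1 1 x = 1 := by
  ext i j
  simp [radMat_apply, tang]

theorem radMat_inv (hx : x ≠ 0) {N T : ℝ} (hN : N ≠ 0) (hT : T ≠ 0) :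
    (radMat N T x)⁻¹ = radMat N⁻¹ T⁻¹ x := by
  refine Matrix.inv_eq_right_inv ?_
  rw [radMat_mul hx, mul_inv_cancel₀ hN, mul_inv_cancel₀ hT, radMat_one]

theorem trace_radMat (hx : x ≠ 0) (N T : ℝ) :
    ∑ i, radMat N T x i i = N + ((n : ℝ) - 1) * T := by
  simp_rw [radMat_apply, Finset.sum_add_distrib, ← Finset.mul_sum, sum_nu_mul_nu hx, sum_tang hx]
  ring

theorem sum_sum_radMat_mul (hx : x ≠ 0) (N T N' T' : ℝ) :
    ∑ i, ∑ j, radMat N T x i j * radMat N' T' x i j = N * N' + ((n : ℝ) - 1) * (T * T') := by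
  rw [← trace_radMat hx, ← radMat_mul hx]
  simp_rw [Matrix.mul_apply]
  exact Finset.sum_congr rfl fun i _ => Finset.sum_congr rfl fun j _ => by
    rw [radMat_comm N' T' x i j]

/-- A multiple of the identity plus a rank-one matrix, so the matrix determinant lemma applies;
dividing by `T` is why `T ≠ 0` is assumed. -/
theorem det_radMat (hx : x ≠ 0) (hn : 1 ≤ n) {N T : ℝ} (hT : T ≠ 0) :
    (radMat N T x).det = N * T ^ (n - 1) := by
  have h1 : radMat N T x = T • (1 + Matrix.replicateCol Unit (((N - T) / T) • nu x) *
      Matrix.replicateRow Unit (nu x)) := by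
    ext i j
    simp [radMat_apply, tang, Matrix.mul_apply]
    field_simp
    ring
  rw [h1, Matrix.det_smul, Matrix.det_one_add_replicateCol_mul_replicateRow]
  have h2 : nu x ⬝ᵥ (((N - T) / T) • nu x) = (N - T) / T := by
    rw [dotProduct_smul, smul_eq_mul]
    simp [dotProduct, sum_nu_mul_nu hx]
  rw [h2, Fintype.card_fin]
  obtain ⟨k, rfl⟩ : ∃ k, n = k + 1 := ⟨n - 1, by omega⟩
  rw [Nat.add_sub_cancel, pow_succ]
  field_simp
  ring

section Pointwise

variable {g : TensorField n} {a c : ℝ}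

theorem tr_radMat (hx : x ≠ 0) (ha : a ≠ 0) (hc : c ≠ 0) (hg : g x = radMat a c x)
    {S : TensorField n} {N T : ℝ} (hS : S x = radMat N T x) :
    tr g S x = N / a + ((n : ℝ) - 1) * (T / c) := by
  rw [tr, hg, hS, radMat_inv hx ha hc, sum_sum_radMat_mul hx]
  ring

theorem normSq_radMat (hx : x ≠ 0) (ha : a ≠ 0) (hc : c ≠ 0) (hg : g x = radMat a c x)
    {S : TensorField n} {N T : ℝ} (hS : S x = radMat N T x) :
    normSq g S x = (N / a) ^ 2 + ((n : ℝ) - 1) * (T / c) ^ 2 := by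
  rw [normSq, hg, hS, radMat_inv hx ha hc]
  -- The two inner sums form the matrix product `g⁻¹ S g⁻¹`, which is again of radial form.
  have h1 : ∀ i j, ∑ p, ∑ q, radMat a⁻¹ c⁻¹ x i p * radMat a⁻¹ c⁻¹ x j q * radMat N T x i j *
      radMat N T x p q = radMat N T x i j * radMat (a⁻¹ * N * a⁻¹) (c⁻¹ * T * c⁻¹) x i j := by
    intro i j
    rw [← radMat_mul hx, ← radMat_mul hx, Matrix.mul_apply, Finset.mul_sum, Finset.sum_comm]
    refine Finset.sum_congr rfl fun q _ => ?_
    rw [Matrix.mul_apply, Finset.sum_mul, Finset.mul_sum]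
    refine Finset.sum_congr rfl fun p _ => ?_
    rw [radMat_comm _ _ x j q]
    ring
  simp_rw [h1]
  rw [sum_sum_radMat_mul hx]
  ring

theorem covectorNormSq_radMat (hx : x ≠ 0) (ha : a ≠ 0) (hc : c ≠ 0) (hg : g x = radMat a c x)
    (w : ℝ) {α : Fin n → ℝ} (hα : ∀ i, α i = w * nu x i) :
    covectorNormSq g α x = w ^ 2 / a := by
  rw [covectorNormSq, hg, radMat_inv hx ha hc]
  have h1 : ∀ i, ∑ j, radMat a⁻¹ c⁻¹ x i j * α i * α j = w ^ 2 * a⁻¹ * (nu x i * nu x i) := by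
    intro i
    have : ∀ j, radMat a⁻¹ c⁻¹ x i j * α i * α j =
        w * α i * (radMat a⁻¹ c⁻¹ x i j * nu x j) := fun j => by rw [hα j]; ring
    simp_rw [this, ← Finset.mul_sum, sum_radMat_mul_nu hx, hα]
    ring
  simp_rw [h1, ← Finset.mul_sum, sum_nu_mul_nu hx]
  ring

theorem volDensity_radMat (hx : x ≠ 0) (hn : 1 ≤ n) (hc : c ≠ 0) (hg : g x = radMat a c x) :
    volDensity g x = √(a * c ^ (n - 1)) := by
  rw [volDensity, hg, det_radMat hx hn hc]

end Pointwise

/-- The derivatives of a radial tensor field. -/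
theorem hasPD_radMat (hx : x ≠ 0) {N T : ℝ → ℝ} {N' T' : ℝ} (hN : HasDerivAt N N' ‖x‖)
    (hT : HasDerivAt T T' ‖x‖) (i j : Fin n) :
    HasPD (fun y => radMat (N ‖y‖) (T ‖y‖) y i j)
      (fun l => nu x l * (N' * (nu x i * nu x j) + T' * tang x i j) +
        (N ‖x‖ - T ‖x‖) / ‖x‖ * (tang x i l * nu x j + nu x i * tang x j l)) x := by
  refine (((hasPD_radial hN hx).mul ((hasPD_nu hx i).mul (hasPD_nu hx j))).add
    ((hasPD_radial hT hx).mul (hasPD_tang hx i j))).congr fun l => ?_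
  ring

theorem pd_of_eventuallyEq_radMat (hx : x ≠ 0) {g : TensorField n} {N T : ℝ → ℝ}
    (hg : ∀ᶠ y in 𝓝 x, g y = radMat (N ‖y‖) (T ‖y‖) y) {N' T' : ℝ}
    (hN : HasDerivAt N N' ‖x‖) (hT : HasDerivAt T T' ‖x‖) (l i j : Fin n) :
    pd l (fun y => g y i j) x = nu x l * (N' * (nu x i * nu x j) + T' * tang x i j) +
        (N ‖x‖ - T ‖x‖) / ‖x‖ * (tang x i l * nu x j + nu x i * tang x j l) :=
  ((hasPD_radMat hx hN hT i j).congr_of_eventuallyEq (hg.mono fun y hy => by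
    beta_reduce; rw [hy])).2 l

/-- The form of the Christoffel symbols of a radial metric. -/
def radGam (Λ β α : ℝ) (x : Space n) (m i j : Fin n) : ℝ :=
  Λ * (nu x i * nu x j * nu x m) + β * (tang x i j * nu x m) +
    α * (nu x i * tang x j m + nu x j * tang x i m)

/-- Each `∂ₗ gᵢⱼ` has a part from the radial derivatives of the coefficients and a part,
proportional to `(a - c)/|x|`, from the turning of `ν`. The alternating sum groups into terms
contracted with `ν` and with the projection, on which `g⁻¹` acts by `1/a` and `1/c`. -/
theorem christoffel_eq_radGam (hx : x ≠ 0) {g : TensorField n} {a c : ℝ → ℝ}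
    (hg : ∀ᶠ y in 𝓝 x, g y = radMat (a ‖y‖) (c ‖y‖) y) {a' c' : ℝ}
    (ha : HasDerivAt a a' ‖x‖) (hc : HasDerivAt c c' ‖x‖) (ha0 : a ‖x‖ ≠ 0) (hc0 : c ‖x‖ ≠ 0)
    (m i j : Fin n) :
    christoffel g m i j x = radGam (a' / (2 * a ‖x‖))
      ((a ‖x‖ - c ‖x‖) / (a ‖x‖ * ‖x‖) - c' / (2 * a ‖x‖)) (c' / (2 * c ‖x‖)) x m i j := by
  have h0 : ‖x‖ ≠ 0 := norm_ne_zero_iff.2 hx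
  rw [christoffel, hg.self_of_nhds, radMat_inv hx ha0 hc0]
  simp_rw [pd_of_eventuallyEq_radMat hx hg ha hc]
  have h1 : ∀ l, radMat (a ‖x‖)⁻¹ (c ‖x‖)⁻¹ x m l *
      (nu x i * (a' * (nu x j * nu x l) + c' * tang x j l) +
        (a ‖x‖ - c ‖x‖) / ‖x‖ * (tang x j i * nu x l + nu x j * tang x l i) +
      (nu x j * (a' * (nu x i * nu x l) + c' * tang x i l) +
        (a ‖x‖ - c ‖x‖) / ‖x‖ * (tang x i j * nu x l + nu x i * tang x l j)) -
      (nu x l * (a' * (nu x i * nu x j) + c' * tang x i j) +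
        (a ‖x‖ - c ‖x‖) / ‖x‖ * (tang x i l * nu x j + nu x i * tang x j l))) =
      (a' * (nu x i * nu x j) + (2 * ((a ‖x‖ - c ‖x‖) / ‖x‖) - c') * tang x i j) *
        (radMat (a ‖x‖)⁻¹ (c ‖x‖)⁻¹ x m l * nu x l) +
      (c' * nu x i) * (radMat (a ‖x‖)⁻¹ (c ‖x‖)⁻¹ x m l * tang x l j) +
      (c' * nu x j) * (radMat (a ‖x‖)⁻¹ (c ‖x‖)⁻¹ x m l * tang x l i) := fun l => by
    rw [tang_comm x l j, tang_comm x l i, tang_comm x j i]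
    ring
  simp_rw [h1, Finset.sum_add_distrib, ← Finset.mul_sum, sum_radMat_mul_nu hx,
    sum_radMat_mul_tang hx]
  rw [radGam, tang_comm x m j, tang_comm x m i]
  field_simp
  ring

/-! ### Curvature of a radial metric -/

theorem hasPD_radGam (hx : x ≠ 0) {Λ β α : ℝ → ℝ} {Λ' β' α' : ℝ} (hΛ : HasDerivAt Λ Λ' ‖x‖)
    (hβ : HasDerivAt β β' ‖x‖) (hα : HasDerivAt α α' ‖x‖) (m i j : Fin n) :
    HasPD (fun y => radGam (Λ ‖y‖) (β ‖y‖) (α ‖y‖) y m i j) (fun l =>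
      nu x l * radGam Λ' β' α' x m i j +
      (Λ ‖x‖ * (tang x i l * nu x j * nu x m + nu x i * tang x j l * nu x m +
        nu x i * nu x j * tang x m l) +
      β ‖x‖ * (tang x i j * tang x m l -
        (tang x i l * nu x j + nu x i * tang x j l) * nu x m) +
      α ‖x‖ * (tang x i l * tang x j m - nu x i * (tang x j l * nu x m + nu x j * tang x m l) +
        tang x j l * tang x i m - nu x j * (tang x i l * nu x m + nu x i * tang x m l))) / ‖x‖) x := by
  refine ((((hasPD_radial hΛ hx).mul (((hasPD_nu hx i).mul (hasPD_nu hx j)).mul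
    (hasPD_nu hx m))).add ((hasPD_radial hβ hx).mul ((hasPD_tang hx i j).mul
    (hasPD_nu hx m)))).add ((hasPD_radial hα hx).mul (((hasPD_nu hx i).mul
    (hasPD_tang hx j m)).add ((hasPD_nu hx j).mul (hasPD_tang hx i m))))).congr fun l => ?_
  rw [radGam]
  ring

theorem sum_radGam_trace (hx : x ≠ 0) (Λ β α : ℝ) (i : Fin n) :
    ∑ m, radGam Λ β α x m i m = (Λ + ((n : ℝ) - 1) * α) * nu x i := by
  have : ∀ m, radGam Λ β α x m i m = Λ * nu x i * (nu x m * nu x m) +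
      (β + α) * (tang x i m * nu x m) + α * nu x i * tang x m m := fun m => by
    rw [radGam]; ring
  simp_rw [this, Finset.sum_add_distrib, ← Finset.mul_sum, sum_nu_mul_nu hx, sum_tang_mul_nu hx,
    sum_tang hx]
  ring

theorem radGam_comm (Λ β α : ℝ) (m i j : Fin n) :
    radGam Λ β α x m i j = radGam Λ β α x m j i := by
  rw [radGam, radGam, tang_comm x i j]; ring

theorem sum_radGam_mul_nu (hx : x ≠ 0) (Λ β α : ℝ) (i j : Fin n) :
    ∑ l, radGam Λ β α x l i j * nu x l = Λ * (nu x i * nu x j) + β * tang x i j := by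
  have : ∀ l, radGam Λ β α x l i j * nu x l =
      (Λ * (nu x i * nu x j) + β * tang x i j) * (nu x l * nu x l) +
      α * nu x i * (tang x j l * nu x l) + α * nu x j * (tang x i l * nu x l) := fun l => by
    rw [radGam]; ring
  simp_rw [this, Finset.sum_add_distrib, ← Finset.mul_sum, sum_nu_mul_nu hx, sum_tang_mul_nu hx]
  ring

theorem sum_radGam_mul_radGam (hx : x ≠ 0) (Λ β α : ℝ) (i j : Fin n) :
    ∑ m, ∑ l, radGam Λ β α x m j l * radGam Λ β α x l i m =
      (Λ ^ 2 + ((n : ℝ) - 1) * α ^ 2) * (nu x i * nu x j) + 2 * α * β * tang x i j := by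
  have h1 : ∀ m l, radGam Λ β α x m j l * radGam Λ β α x l i m =
      Λ * nu x j * nu x m * (radGam Λ β α x l i m * nu x l) +
      β * nu x m * (Λ * nu x i * nu x m * (tang x j l * nu x l) +
        β * tang x i m * (tang x j l * nu x l) +
        α * nu x i * (tang x j l * tang x l m) + α * nu x m * (tang x j l * tang x l i)) +
      α * nu x j * (Λ * nu x i * nu x m * (tang x m l * nu x l) +
        β * tang x i m * (tang x m l * nu x l) +
        α * nu x i * (tang x m l * tang x l m) + α * nu x m * (tang x m l * tang x l i)) +
      α * tang x j m * (radGam Λ β α x l i m * nu x l) := fun m l => by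
    simp only [radGam, tang_comm x l m, tang_comm x l i]
    ring
  have h2 : ∀ m, ∑ l, radGam Λ β α x m j l * radGam Λ β α x l i m =
      (Λ ^ 2 * (nu x i * nu x j) + α * β * tang x i j) * (nu x m * nu x m) +
      Λ * β * nu x j * (tang x i m * nu x m) +
      (β * α * nu x i + α * Λ * nu x i) * (tang x j m * nu x m) +
      α ^ 2 * (nu x i * nu x j) * tang x m m + α ^ 2 * nu x j * (tang x i m * nu x m) +
      α * β * (tang x i m * tang x m j) := fun m => by
    simp_rw [h1, Finset.sum_add_distrib, ← Finset.mul_sum, Finset.sum_add_distrib, ← Finset.mul_sum, sum_radGam_mul_nu hx,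
      sum_tang_mul_nu hx, sum_tang_mul_tang hx]
    rw [tang_comm x j i, tang_comm x m i, tang_comm x m j]
    ring
  simp_rw [h2, Finset.sum_add_distrib, ← Finset.mul_sum, sum_nu_mul_nu hx, sum_tang_mul_nu hx,
    sum_tang_mul_tang hx, sum_tang hx]
  ring

/-- The two derivative sums `h2` and `h3` and the two quadratic sums are evaluated separately. `Λ'`
occurs equally in `h2` and `h3` and cancels. -/
theorem ricci_eq_radMat (hx : x ≠ 0) {g : TensorField n} {Λ β α : ℝ → ℝ} {Λ' β' α' : ℝ}
    (hg : ∀ᶠ y in 𝓝 x, ∀ m i j,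
      christoffel g m i j y = radGam (Λ ‖y‖) (β ‖y‖) (α ‖y‖) y m i j)
    (hΛ : HasDerivAt Λ Λ' ‖x‖) (hβ : HasDerivAt β β' ‖x‖) (hα : HasDerivAt α α' ‖x‖)
    (i j : Fin n) :
    ricci g i j x = radMat
      (((n : ℝ) - 1) * ((Λ ‖x‖ - 2 * α ‖x‖) / ‖x‖ - α' + α ‖x‖ * Λ ‖x‖ - α ‖x‖ ^ 2))
      (β' + (((n : ℝ) - 1) * β ‖x‖ + 2 * α ‖x‖ - (Λ ‖x‖ + ((n : ℝ) - 1) * α ‖x‖)) / ‖x‖ +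
        (Λ ‖x‖ + ((n : ℝ) - 3) * α ‖x‖) * β ‖x‖) x i j := by
  have h0 : ‖x‖ ≠ 0 := norm_ne_zero_iff.2 hx
  have hpd : ∀ l m i j, pd l (christoffel g m i j) x = _ := fun l m i j =>
    ((hasPD_radGam hx hΛ hβ hα m i j).congr_of_eventuallyEq (hg.mono fun y hy => hy m i j)).2 l
  have h1 : ∑ m, ∑ l, radGam (Λ ‖x‖) (β ‖x‖) (α ‖x‖) x m m l *
      radGam (Λ ‖x‖) (β ‖x‖) (α ‖x‖) x l i j =
      (Λ ‖x‖ + ((n : ℝ) - 1) * α ‖x‖) * (Λ ‖x‖ * (nu x i * nu x j) + β ‖x‖ * tang x i j) := by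
    rw [Finset.sum_comm, ← sum_radGam_mul_nu hx _ _ (α ‖x‖), Finset.mul_sum]
    refine Finset.sum_congr rfl fun l _ => ?_
    rw [← Finset.sum_mul]
    simp_rw [radGam_comm (x := x) (Λ ‖x‖) (β ‖x‖) (α ‖x‖) _ _ l]
    rw [sum_radGam_trace hx]
    ring
  have h2 : ∑ m, pd m (christoffel g m i j) x =
      (Λ' + (((n : ℝ) - 1) * Λ ‖x‖ - 2 * ((n : ℝ) - 1) * α ‖x‖) / ‖x‖) * (nu x i * nu x j) +
      (β' + (((n : ℝ) - 1) * β ‖x‖ + 2 * α ‖x‖) / ‖x‖) * tang x i j := by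
    have : ∀ m, pd m (christoffel g m i j) x =
        (radGam Λ' β' α' x m i j * nu x m) +
        (((Λ ‖x‖ - β ‖x‖ - α ‖x‖) / ‖x‖ * nu x j) * (tang x i m * nu x m) +
        ((Λ ‖x‖ - β ‖x‖ - α ‖x‖) / ‖x‖ * nu x i) * (tang x j m * nu x m) +
        ((Λ ‖x‖ - 2 * α ‖x‖) / ‖x‖ * (nu x i * nu x j) + β ‖x‖ / ‖x‖ * tang x i j) * tang x m m +
        2 * α ‖x‖ / ‖x‖ * (tang x i m * tang x m j)) := fun m => by
      rw [hpd]; beta_reduce; rw [tang_comm x m j]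
      ring
    simp_rw [this, Finset.sum_add_distrib, ← Finset.mul_sum, sum_radGam_mul_nu hx,
      sum_tang_mul_nu hx, sum_tang_mul_tang hx, sum_tang hx]
    ring
  have h3 : ∑ m, pd j (christoffel g m i m) x =
      (Λ' + ((n : ℝ) - 1) * α') * (nu x i * nu x j) +
      (Λ ‖x‖ + ((n : ℝ) - 1) * α ‖x‖) / ‖x‖ * tang x i j := by
    have : ∀ m, pd j (christoffel g m i m) x =
        nu x j * radGam Λ' β' α' x m i m +
        (Λ ‖x‖ / ‖x‖ * tang x i j * (nu x m * nu x m) +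
        ((2 * Λ ‖x‖ - β ‖x‖ - 3 * α ‖x‖) / ‖x‖ * nu x i) *
          (tang x j m * nu x m) +
        (-(β ‖x‖ + α ‖x‖) / ‖x‖ * tang x i j) * (nu x m * nu x m) +
        α ‖x‖ / ‖x‖ * tang x i j * tang x m m +
        (β ‖x‖ + α ‖x‖) / ‖x‖ * (tang x i m * tang x m j)) := fun m => by
      rw [hpd]; beta_reduce; rw [tang_comm x m j]
      ring
    simp_rw [this, Finset.sum_add_distrib, ← Finset.mul_sum, sum_radGam_trace hx,
      sum_tang_mul_nu hx, sum_tang_mul_tang hx, sum_tang hx, sum_nu_mul_nu hx]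
    ring
  simp_rw [ricci, Finset.sum_add_distrib, Finset.sum_sub_distrib, h2, h3, hg.self_of_nhds]
  rw [h1, sum_radGam_mul_radGam hx, radMat_apply]
  field_simp
  ring

/-- Near `x`, the metric is `s(r)² dr² + ρ(r)² g_{S^{n-1}}`, with `ρ' = s X`. -/
structure RadialMetricAt (g : TensorField n) (s ρ X s' : ℝ → ℝ) (s'' X' : ℝ) (x : Space n) :
    Prop where
  ne_zero : x ≠ 0
  s_pos : 0 < s ‖x‖
  rho_pos : 0 < ρ ‖x‖
  eq_radMat : ∀ᶠ y in 𝓝 x, g y = radMat (s ‖y‖ ^ 2) ((ρ ‖y‖ / ‖y‖) ^ 2) y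
  deriv_rho : ∀ᶠ r in 𝓝 ‖x‖, HasDerivAt ρ (s r * X r) r
  deriv_s : ∀ᶠ r in 𝓝 ‖x‖, HasDerivAt s (s' r) r
  deriv_s' : HasDerivAt s' s'' ‖x‖
  deriv_X : HasDerivAt X X' ‖x‖

theorem eventually_norm {p : ℝ → Prop} (hp : ∀ᶠ r in 𝓝 ‖x‖, p r) : ∀ᶠ y in 𝓝 x, p ‖y‖ :=
  continuous_norm.continuousAt.eventually hp

namespace RadialMetricAt

variable {g : TensorField n} {s ρ X s' : ℝ → ℝ} {s'' X' : ℝ}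

theorem norm_pos (h : RadialMetricAt g s ρ X s' s'' X' x) : 0 < ‖x‖ := norm_pos_iff.2 h.ne_zero

theorem sq_s_ne (h : RadialMetricAt g s ρ X s' s'' X' x) : s ‖x‖ ^ 2 ≠ 0 :=
  pow_ne_zero 2 h.s_pos.ne'

theorem sq_rho_ne (h : RadialMetricAt g s ρ X s' s'' X' x) : (ρ ‖x‖ / ‖x‖) ^ 2 ≠ 0 :=
  pow_ne_zero 2 (div_ne_zero h.rho_pos.ne' h.norm_pos.ne')

theorem christoffel_eq (h : RadialMetricAt g s ρ X s' s'' X' x) :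
    ∀ᶠ y in 𝓝 x, ∀ m i j, christoffel g m i j y = radGam (s' ‖y‖ / s ‖y‖)
      (1 / ‖y‖ - ρ ‖y‖ * X ‖y‖ / (s ‖y‖ * ‖y‖ ^ 2)) (s ‖y‖ * X ‖y‖ / ρ ‖y‖ - 1 / ‖y‖) y m i j := by
  have h1 := (h.deriv_s.self_of_nhds.continuousAt.eventually (lt_mem_nhds h.s_pos))
  have h2 := (h.deriv_rho.self_of_nhds.continuousAt.eventually (lt_mem_nhds h.rho_pos))
  filter_upwards [h.eq_radMat.eventually_nhds, eventually_norm h.deriv_rho,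
    eventually_norm h.deriv_s, eventually_norm h1, eventually_norm h2,
    isOpen_ne.mem_nhds h.ne_zero] with y hy hρ hs hs0 hρ0 hy0 m i j
  have h0 : ‖y‖ ≠ 0 := norm_ne_zero_iff.2 hy0
  have hc := (hρ.fun_div (hasDerivAt_id ‖y‖) h0).fun_pow 2
  simp only [id_eq] at hc
  rw [christoffel_eq_radGam (a := fun r => s r ^ 2) (c := fun r => (ρ r / r) ^ 2) hy0 hy
    (hs.fun_pow 2) hc (pow_ne_zero 2 hs0.ne') (pow_ne_zero 2 (div_ne_zero hρ0.ne' h0))]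
  congr 1
  · push_cast
    field_simp
  · push_cast
    field_simp
    ring
  · push_cast
    field_simp

/-- The scalar curvature of `s(r)² dr² + ρ(r)² g_{S^{n-1}}`. -/
theorem scalarCurvature_eq (h : RadialMetricAt g s ρ X s' s'' X' x) :
    scalarCurvature g x = -(2 * ((n : ℝ) - 1) * X' / (s ‖x‖ * ρ ‖x‖)) +
      ((n : ℝ) - 1) * ((n : ℝ) - 2) * (1 - X ‖x‖ ^ 2) / ρ ‖x‖ ^ 2 := by
  have h0 := h.norm_pos.ne'
  have hs0 := h.s_pos.ne'
  have hρ0 := h.rho_pos.ne'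
  have hs := h.deriv_s.self_of_nhds
  have hρ := h.deriv_rho.self_of_nhds
  have hid := hasDerivAt_id ‖x‖
  have hinv := (hasDerivAt_const ‖x‖ (1 : ℝ)).fun_div hid h0
  -- This is the only place where `s''` enters, and `Λ'` is absent from the Ricci tensor, so the
  -- final formula involves only `X'`.
  have hΛ := h.deriv_s'.fun_div hs hs0
  have hβ := hinv.fun_sub ((hρ.fun_mul h.deriv_X).fun_div (hs.fun_mul (hid.fun_pow 2))
    (mul_ne_zero hs0 (pow_ne_zero 2 h0)))
  have hα := ((hs.fun_mul h.deriv_X).fun_div hρ hρ0).fun_sub hinv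
  have hR := ricci_eq_radMat h.ne_zero (Λ := fun r => s' r / s r)
    (β := fun r => 1 / r - ρ r * X r / (s r * r ^ 2))
    (α := fun r => s r * X r / ρ r - 1 / r) h.christoffel_eq hΛ hβ hα
  rw [scalarCurvature, h.eq_radMat.self_of_nhds, radMat_inv h.ne_zero h.sq_s_ne h.sq_rho_ne]
  simp_rw [hR]
  rw [sum_sum_radMat_mul h.ne_zero]
  simp only [id_eq]
  push_cast
  field_simp
  ring

theorem sum_radGam_mul_radMat (hx : x ≠ 0) (Λ β α N T : ℝ) (l i j : Fin n) :
    ∑ m, radGam Λ β α x m l i * radMat N T x m j =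
      N * nu x j * (Λ * (nu x l * nu x i) + β * tang x l i) +
      T * α * (nu x l * tang x i j + nu x i * tang x l j) := by
  have : ∀ m, radGam Λ β α x m l i * radMat N T x m j =
      (Λ * (nu x l * nu x i) + β * tang x l i) * (radMat N T x j m * nu x m) +
      α * nu x l * (radMat N T x j m * tang x m i) +
      α * nu x i * (radMat N T x j m * tang x m l) := fun m => by
    rw [radGam, radMat_comm N T x j m, tang_comm x m i, tang_comm x m l]; ring
  simp_rw [this, Finset.sum_add_distrib, ← Finset.mul_sum, sum_radMat_mul_nu hx,
    sum_radMat_mul_tang hx]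
  rw [tang_comm x j i, tang_comm x j l]
  ring

/-- The divergence of `P s² dr² + Q ρ² g_{S^{n-1}}`. -/
theorem divergence_eq (h : RadialMetricAt g s ρ X s' s'' X' x) {S : TensorField n} {P Q : ℝ → ℝ}
    (hS : ∀ᶠ y in 𝓝 x, S y = radMat (P ‖y‖ * s ‖y‖ ^ 2) (Q ‖y‖ * (ρ ‖y‖ / ‖y‖) ^ 2) y)
    {P' Q' : ℝ} (hP : HasDerivAt P P' ‖x‖) (hQ : HasDerivAt Q Q' ‖x‖) (i : Fin n) :
    divergence g S i x =
      (P' + ((n : ℝ) - 1) * (s ‖x‖ * X ‖x‖ / ρ ‖x‖) * (P ‖x‖ - Q ‖x‖)) * nu x i := by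
  have hx := h.ne_zero
  have h0 := h.norm_pos.ne'
  have hs0 := h.s_pos.ne'
  have hρ0 := h.rho_pos.ne'
  have hs := h.deriv_s.self_of_nhds
  have hρ := h.deriv_rho.self_of_nhds
  have hid := hasDerivAt_id ‖x‖
  have hp := hP.fun_mul (hs.fun_pow 2)
  have hq := hQ.fun_mul ((hρ.fun_div hid h0).fun_pow 2)
  have hpd := pd_of_eventuallyEq_radMat hx (N := fun r => P r * s r ^ 2)
    (T := fun r => Q r * (ρ r / r) ^ 2) hS hp hq
  set p' := P' * s ‖x‖ ^ 2 + P ‖x‖ * (↑2 * s ‖x‖ ^ (2 - 1) * s' ‖x‖) with hp'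
  set q' := Q' * (ρ ‖x‖ / id ‖x‖) ^ 2 + Q ‖x‖ * (↑2 * (ρ ‖x‖ / id ‖x‖) ^ (2 - 1) *
    ((s ‖x‖ * X ‖x‖ * id ‖x‖ - ρ ‖x‖ * 1) / id ‖x‖ ^ 2)) with hq'
  set p := P ‖x‖ * s ‖x‖ ^ 2
  set q := Q ‖x‖ * (ρ ‖x‖ / ‖x‖) ^ 2
  set Λ := s' ‖x‖ / s ‖x‖
  set β := 1 / ‖x‖ - ρ ‖x‖ * X ‖x‖ / (s ‖x‖ * ‖x‖ ^ 2)
  set α := s ‖x‖ * X ‖x‖ / ρ ‖x‖ - 1 / ‖x‖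
  have hcov : ∀ l i j, covDeriv g S l i j x =
      nu x l * ((p' - 2 * Λ * p) * (nu x i * nu x j) + (q' - 2 * α * q) * tang x i j) +
      ((p - q) / ‖x‖ - β * p - α * q) * (tang x i l * nu x j + nu x i * tang x j l) := by
    intro l i j
    rw [covDeriv, hpd]
    simp_rw [h.christoffel_eq.self_of_nhds, hS.self_of_nhds, Finset.sum_add_distrib]
    rw [sum_radGam_mul_radMat hx]
    simp_rw [radMat_comm _ _ x i _]
    rw [sum_radGam_mul_radMat hx, tang_comm x l j, tang_comm x l i, tang_comm x j i]
    simp only [p, q]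
    ring
  rw [divergence, h.eq_radMat.self_of_nhds, radMat_inv hx h.sq_s_ne h.sq_rho_ne]
  simp_rw [hcov]
  set A := (s ‖x‖ ^ 2)⁻¹
  set B := ((ρ ‖x‖ / ‖x‖) ^ 2)⁻¹
  -- Inserting the definitions gives `K = s ρ X (P - Q)/|x|²`, the source of the `P - Q` term in the
  -- divergence.
  set K := (p - q) / ‖x‖ - β * p - α * q with hK
  have h1 : ∀ j, ∑ l, radMat A B x j l * (nu x l * ((p' - 2 * Λ * p) * (nu x i * nu x j) +
      (q' - 2 * α * q) * tang x i j) + K * (tang x i l * nu x j + nu x i * tang x j l)) =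
      A * (p' - 2 * Λ * p) * nu x i * (nu x j * nu x j) +
      (A * (q' - 2 * α * q) + K * B) * (tang x i j * nu x j) +
      K * B * nu x i * tang x j j := by
    intro j
    have : ∀ l, radMat A B x j l * (nu x l * ((p' - 2 * Λ * p) * (nu x i * nu x j) +
        (q' - 2 * α * q) * tang x i j) + K * (tang x i l * nu x j + nu x i * tang x j l)) =
        ((p' - 2 * Λ * p) * (nu x i * nu x j) + (q' - 2 * α * q) * tang x i j) *
          (radMat A B x j l * nu x l) + K * nu x j * (radMat A B x j l * tang x l i) +
        K * nu x i * (radMat A B x j l * tang x l j) := fun l => by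
      rw [tang_comm x l i, tang_comm x l j]; ring
    simp_rw [this, Finset.sum_add_distrib, ← Finset.mul_sum, sum_radMat_mul_nu hx,
      sum_radMat_mul_tang hx]
    rw [tang_comm x j i]
    ring
  simp_rw [h1, Finset.sum_add_distrib, ← Finset.mul_sum, sum_nu_mul_nu hx, sum_tang_mul_nu hx,
    sum_tang hx]
  simp only [hK, hp', p, q, Λ, α, β, A, B]
  push_cast
  field_simp
  ring

/-- The Hessian of a radial function. -/
theorem hessian_eq (h : RadialMetricAt g s ρ X s' s'' X' x) {f : Space n → ℝ} {φ φ' : ℝ → ℝ}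
    {φ'' : ℝ} (hf : ∀ᶠ y in 𝓝 x, f y = φ ‖y‖) (hφ : ∀ᶠ r in 𝓝 ‖x‖, HasDerivAt φ (φ' r) r)
    (hφ' : HasDerivAt φ' φ'' ‖x‖) (i j : Fin n) :
    hessian g f i j x = radMat (φ'' - s' ‖x‖ / s ‖x‖ * φ' ‖x‖)
      (ρ ‖x‖ * X ‖x‖ / (s ‖x‖ * ‖x‖ ^ 2) * φ' ‖x‖) x i j := by
  have hx := h.ne_zero
  have hpd : ∀ᶠ y in 𝓝 x, ∀ j, pd j f y = φ' ‖y‖ * nu y j := by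
    filter_upwards [hf.eventually_nhds, eventually_norm hφ, isOpen_ne.mem_nhds hx]
      with y hy hy' hy0 j
    exact ((hasPD_radial hy' hy0).congr_of_eventuallyEq hy).2 j
  have h2 : pd i (pd j f) x = φ'' * nu x i * nu x j + φ' ‖x‖ * (tang x j i / ‖x‖) :=
    (((hasPD_radial hφ' hx).mul (hasPD_nu hx j)).congr_of_eventuallyEq
      (hpd.mono fun y hy => hy j)).2 i
  rw [hessian, h2]
  simp_rw [h.christoffel_eq.self_of_nhds, hpd.self_of_nhds, mul_left_comm _ (φ' ‖x‖),
    ← Finset.mul_sum]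
  rw [sum_radGam_mul_nu hx, radMat_apply, tang_comm x j i]
  field_simp
  ring

end RadialMetricAt

end Riem

open Riem

/-! ### The interior of `M` and restriction to coordinate rays -/

namespace InitialData

variable {n : ℕ} {D : InitialData n} {x : Space n}

theorem mem_inner_of_lt (hx : D.r₀ < ‖x‖) : x ∈ D.inner :=
  interior_maximal (fun _ hy => le_of_lt hy) (isOpen_lt continuous_const continuous_norm) hx

theorem lt_norm_of_mem_inner (hx : x ∈ D.inner) (h0 : x ≠ 0) : D.r₀ < ‖x‖ := by
  -- An interior point can be moved slightly towards the origin without leaving `M`, so its norm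
  -- exceeds `r₀` strictly.
  have hc : Tendsto (fun t : ℝ => t • x) (𝓝[<] 1) (𝓝 x) := by
    have : Tendsto (fun t : ℝ => t • x) (𝓝 1) (𝓝 ((1 : ℝ) • x)) :=
      (continuous_id.smul continuous_const).continuousAt
    rw [one_smul] at this
    exact this.mono_left nhdsWithin_le_nhds
  obtain ⟨t, ht, ht0, ht1⟩ := ((hc.eventually (mem_interior_iff_mem_nhds.1 hx)).and
    (Ioo_mem_nhdsLT (zero_lt_one (α := ℝ)))).exists
  have h1 : D.r₀ ≤ ‖t • x‖ := ht
  rw [norm_smul, Real.norm_eq_abs, abs_of_pos ht0] at h1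
  nlinarith [norm_pos_iff.2 h0]

end InitialData

namespace Riem

variable {n : ℕ}

theorem norm_single_of_nonneg (i : Fin n) {r : ℝ} (hr : 0 ≤ r) :
    ‖(EuclideanSpace.single i r : Space n)‖ = r := by
  rw [PiLp.norm_single, Real.norm_eq_abs, abs_of_nonneg hr]

theorem nu_single (i j : Fin n) {r : ℝ} (hr : 0 < r) :
    nu (EuclideanSpace.single i r : Space n) j = (1 : Matrix (Fin n) (Fin n) ℝ) i j := by
  rw [nu, norm_single_of_nonneg i hr.le]
  by_cases h : i = j
  · subst h; simp [hr.ne']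
  · simp [h, Ne.symm h]

theorem radMat_single_self (N T : ℝ) (i : Fin n) {r : ℝ} (hr : 0 < r) :
    radMat N T (EuclideanSpace.single i r : Space n) i i = N := by
  simp [radMat_apply, tang, nu_single i _ hr]

theorem radMat_single_ne (N T : ℝ) {i j : Fin n} (hij : i ≠ j) {r : ℝ} (hr : 0 < r) :
    radMat N T (EuclideanSpace.single i r : Space n) j j = T := by
  simp [radMat_apply, tang, nu_single i _ hr, hij]

theorem contDiff_single (i : Fin n) :
    ContDiff ℝ ∞ (fun r : ℝ => (EuclideanSpace.single i r : Space n)) := by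
  have : (fun r : ℝ => (EuclideanSpace.single i r : Space n)) =
      fun r => r • (EuclideanSpace.single i 1 : Space n) := by
    ext r j
    by_cases h : j = i
    · subst h; simp
    · simp [h]
  rw [this]
  exact contDiff_id.smul contDiff_const

end Riem

/-! ### Regularity of the radial profiles -/

namespace SphericalData

variable {n : ℕ} (D : SphericalData n)

theorem g_eq_radMat {x : Space n} (hx : D.r₀ ≤ ‖x‖) (h0 : x ≠ 0) :
    D.g x = radMat (D.g₁₁ ‖x‖) ((D.rho ‖x‖ / ‖x‖) ^ 2) x := by
  ext i j; exact D.g_eq x hx h0 i j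

theorem k_eq_radMat {x : Space n} (hx : D.r₀ ≤ ‖x‖) (h0 : x ≠ 0) :
    D.k x = radMat (D.kn ‖x‖ * D.g₁₁ ‖x‖) (D.kt ‖x‖ * (D.rho ‖x‖ / ‖x‖) ^ 2) x := by
  ext i j; exact D.k_eq x hx h0 i j

/-- The component of a tensor field along a ray. -/
def rayComp (S : TensorField n) (i j : Fin n) (r : ℝ) : ℝ := S (EuclideanSpace.single i r) j j

theorem contDiffOn_rayComp {r₀ : ℝ} (hr₀ : 0 ≤ r₀) {S : TensorField n}
    (hS : ∀ i j, ContDiffOn ℝ ∞ (fun x => S x i j) {x | r₀ ≤ ‖x‖}) (i j : Fin n) :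
    ContDiffOn ℝ ∞ (rayComp S i j) (Set.Ici r₀) :=
  (hS j j).comp (contDiff_single i).contDiffOn fun r hr => by
    rw [Set.mem_ofPred_eq, norm_single_of_nonneg i (hr₀.trans hr)]; exact hr

theorem rayComp_g_pos (i j : Fin n) {r : ℝ} (hr : D.r₀ ≤ r) : 0 < rayComp D.g i j r :=
  (D.g_posDef _ (by rwa [norm_single_of_nonneg i (D.r₀_nonneg.trans hr)])).diag_pos

theorem single_ne_zero' (i : Fin n) {r : ℝ} (hr : 0 < r) :
    (EuclideanSpace.single i r : Space n) ≠ 0 := by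
  rw [← norm_ne_zero_iff, norm_single_of_nonneg i hr.le]; exact hr.ne'

theorem rayComp_g_self (i : Fin n) {r : ℝ} (hr : D.r₀ ≤ r) (h0 : 0 < r) :
    rayComp D.g i i r = D.g₁₁ r := by
  have h1 := norm_single_of_nonneg i h0.le
  rw [rayComp, D.g_eq_radMat (by rwa [h1]) (single_ne_zero' i h0), radMat_single_self _ _ _ h0, h1]

theorem rayComp_g_ne {i j : Fin n} (hij : i ≠ j) {r : ℝ} (hr : D.r₀ ≤ r) (h0 : 0 < r) :
    rayComp D.g i j r = (D.rho r / r) ^ 2 := by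
  have h1 := norm_single_of_nonneg i h0.le
  rw [rayComp, D.g_eq_radMat (by rwa [h1]) (single_ne_zero' i h0), radMat_single_ne _ _ hij h0, h1]

theorem rayComp_k_self (i : Fin n) {r : ℝ} (hr : D.r₀ ≤ r) (h0 : 0 < r) :
    rayComp D.k i i r = D.kn r * D.g₁₁ r := by
  have h1 := norm_single_of_nonneg i h0.le
  rw [rayComp, D.k_eq_radMat (by rwa [h1]) (single_ne_zero' i h0), radMat_single_self _ _ _ h0, h1]

theorem rayComp_k_ne {i j : Fin n} (hij : i ≠ j) {r : ℝ} (hr : D.r₀ ≤ r) (h0 : 0 < r) :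
    rayComp D.k i j r = D.kt r * (D.rho r / r) ^ 2 := by
  have h1 := norm_single_of_nonneg i h0.le
  rw [rayComp, D.k_eq_radMat (by rwa [h1]) (single_ne_zero' i h0), radMat_single_ne _ _ hij h0, h1]

/-- Along the ray in direction `i`, the `ii` components carry the radial profiles and the `jj`
components with `j ≠ i` the tangential ones. -/
theorem exists_ne (hn : 3 ≤ n) : ∃ i j : Fin n, i ≠ j :=
  ⟨⟨0, by omega⟩, ⟨1, by omega⟩, by simp⟩

theorem g₁₁_pos (hn : 3 ≤ n) {r : ℝ} (hr : D.r₀ ≤ r) (h0 : 0 < r) : 0 < D.g₁₁ r := by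
  obtain ⟨i, -, -⟩ := exists_ne hn
  rw [← D.rayComp_g_self i hr h0]
  exact D.rayComp_g_pos i i hr

/-- The area radius is a smooth function up to the boundary. -/
theorem rho_eq {i j : Fin n} (hij : i ≠ j) {r : ℝ} (hr : D.r₀ ≤ r) :
    D.rho r = r * √(rayComp D.g i j r) := by
  rcases (D.r₀_nonneg.trans hr).eq_or_lt with h0 | h0
  · subst h0
    rw [zero_mul, D.rho_zero (le_antisymm hr D.r₀_nonneg)]
  · rw [D.rayComp_g_ne hij hr h0, Real.sqrt_sq (div_pos (D.rho_pos r hr h0) h0).le]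
    field_simp

/-- `ρ = r √gⱼⱼ` along a ray, and `gⱼⱼ` is smooth and positive even at the origin. Hence `ρ` is
smooth up to a center, where the quotient `ρ/r` has no meaning. -/
theorem contDiffOn_rho (hn : 3 ≤ n) : ContDiffOn ℝ ∞ D.rho (Set.Ici D.r₀) := by
  obtain ⟨i, j, hij⟩ := exists_ne hn
  exact (contDiffOn_id.mul ((contDiffOn_rayComp D.r₀_nonneg D.g_smooth i j).sqrt
    fun r hr => (D.rayComp_g_pos i j hr).ne')).congr fun r hr => D.rho_eq hij hr

/-- The part of `[r₀, ∞)` away from the origin. -/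
def radii : Set ℝ := Set.Ici D.r₀ ∩ Set.Ioi 0

theorem contDiffOn_g₁₁ (hn : 3 ≤ n) : ContDiffOn ℝ ∞ D.g₁₁ D.radii := by
  obtain ⟨i, j, hij⟩ := exists_ne hn
  exact ((contDiffOn_rayComp D.r₀_nonneg D.g_smooth i i).mono Set.inter_subset_left).congr
    fun r hr => (D.rayComp_g_self i hr.1 hr.2).symm

theorem contDiffOn_sqrt_g₁₁ (hn : 3 ≤ n) : ContDiffOn ℝ ∞ (fun r => √(D.g₁₁ r)) D.radii :=
  (D.contDiffOn_g₁₁ hn).sqrt fun _ hr => (D.g₁₁_pos hn hr.1 hr.2).ne'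

theorem contDiffOn_kn (hn : 3 ≤ n) : ContDiffOn ℝ ∞ D.kn D.radii := by
  obtain ⟨i, j, hij⟩ := exists_ne hn
  refine (((contDiffOn_rayComp D.r₀_nonneg D.k_smooth i i).mono Set.inter_subset_left).div
    (D.contDiffOn_g₁₁ hn) fun r hr => (D.g₁₁_pos hn hr.1 hr.2).ne').congr fun r hr => ?_
  rw [Pi.div_apply, D.rayComp_k_self i hr.1 hr.2,
    mul_div_cancel_right₀ _ (D.g₁₁_pos hn hr.1 hr.2).ne']

theorem contDiffOn_kt (hn : 3 ≤ n) : ContDiffOn ℝ ∞ D.kt D.radii := by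
  obtain ⟨i, j, hij⟩ := exists_ne hn
  refine (((contDiffOn_rayComp D.r₀_nonneg D.k_smooth i j).div
    (contDiffOn_rayComp D.r₀_nonneg D.g_smooth i j) fun r hr =>
      (D.rayComp_g_pos i j hr).ne').mono Set.inter_subset_left).congr fun r hr => ?_
  have : (D.rho r / r) ^ 2 ≠ 0 := pow_ne_zero 2 (div_pos (D.rho_pos r hr.1 hr.2) hr.2).ne'
  rw [Pi.div_apply, D.rayComp_k_ne hij hr.1 hr.2, D.rayComp_g_ne hij hr.1 hr.2,
    mul_div_cancel_right₀ _ this]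

theorem radii_mem_nhds {r : ℝ} (hr : D.r₀ < r) : D.radii ∈ 𝓝 r :=
  inter_mem (Ici_mem_nhds hr) (Ioi_mem_nhds (D.r₀_nonneg.trans_lt hr))

/-- `X = ρ' / √g₁₁`, the derivative of the area radius by arclength. -/
def expansion (r : ℝ) : ℝ := derivWithin D.rho (Set.Ici D.r₀) r / √(D.g₁₁ r)

/-- `Y = ρ kₜ`. -/
def shear (r : ℝ) : ℝ := D.rho r * D.kt r

theorem contDiffOn_expansion (hn : 3 ≤ n) : ContDiffOn ℝ ∞ D.expansion D.radii :=
  (((D.contDiffOn_rho hn).derivWithin (m := ∞) (uniqueDiffOn_Ici _) (by simp)).mono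
    Set.inter_subset_left).div (D.contDiffOn_sqrt_g₁₁ hn) fun r hr =>
      (Real.sqrt_pos.2 (D.g₁₁_pos hn hr.1 hr.2)).ne'

theorem contDiffOn_shear (hn : 3 ≤ n) : ContDiffOn ℝ ∞ D.shear D.radii :=
  ((D.contDiffOn_rho hn).mono Set.inter_subset_left).mul (D.contDiffOn_kt hn)

variable {D} in
theorem hasDerivAt_of_contDiffOn_radii {F : ℝ → ℝ} (hF : ContDiffOn ℝ ∞ F D.radii) {r : ℝ}
    (hr : D.r₀ < r) : HasDerivAt F (deriv F r) r ∧ HasDerivAt (deriv F) (deriv (deriv F) r) r := by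
  have h1 := hF.contDiffAt (D.radii_mem_nhds hr)
  exact ⟨(h1.differentiableAt (by simp)).hasDerivAt,
    ((h1.derivWithin (m := ∞) (by simp)).differentiableAt (by simp)).hasDerivAt⟩

theorem hasDerivAt_rho (hn : 3 ≤ n) {r : ℝ} (hr : D.r₀ < r) :
    HasDerivAt D.rho (√(D.g₁₁ r) * D.expansion r) r := by
  have h := hasDerivAt_of_contDiffOn_radii
    ((D.contDiffOn_rho hn).mono (Set.inter_subset_left (t := Set.Ioi 0))) hr
  have h0 := (Real.sqrt_pos.2 (D.g₁₁_pos hn hr.le (D.r₀_nonneg.trans_lt hr))).ne'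
  rw [expansion, derivWithin_of_mem_nhds (Ici_mem_nhds hr), mul_div_cancel₀ _ h0]
  exact h.1

theorem radialMetricAt (hn : 3 ≤ n) {x : Space n} (hx : D.r₀ < ‖x‖) :
    RadialMetricAt D.g (fun r => √(D.g₁₁ r)) D.rho D.expansion (deriv fun r => √(D.g₁₁ r))
      (deriv (deriv fun r => √(D.g₁₁ r)) ‖x‖) (deriv D.expansion ‖x‖) x where
  ne_zero := norm_pos_iff.1 (D.r₀_nonneg.trans_lt hx)
  s_pos := Real.sqrt_pos.2 (D.g₁₁_pos hn hx.le (D.r₀_nonneg.trans_lt hx))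
  rho_pos := D.rho_pos _ hx.le (D.r₀_nonneg.trans_lt hx)
  eq_radMat := by
    filter_upwards [(isOpen_lt continuous_const continuous_norm).mem_nhds hx] with y hy
    have hy0 := D.r₀_nonneg.trans_lt hy
    rw [D.g_eq_radMat (le_of_lt hy) (norm_pos_iff.1 hy0),
      Real.sq_sqrt (D.g₁₁_pos hn (le_of_lt hy) hy0).le]
  deriv_rho := by
    filter_upwards [lt_mem_nhds hx] with r hr using D.hasDerivAt_rho hn hr
  deriv_s := by
    filter_upwards [lt_mem_nhds hx] with r hr
      using (hasDerivAt_of_contDiffOn_radii (D.contDiffOn_sqrt_g₁₁ hn) hr).1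
  deriv_s' := (hasDerivAt_of_contDiffOn_radii (D.contDiffOn_sqrt_g₁₁ hn) hx).2
  deriv_X := (hasDerivAt_of_contDiffOn_radii (D.contDiffOn_expansion hn) hx).1

section

variable {x : Space n}

theorem sqrt_sq_g₁₁ (hn : 3 ≤ n) {r : ℝ} (hr : D.r₀ < r) : √(D.g₁₁ r) ^ 2 = D.g₁₁ r :=
  Real.sq_sqrt (D.g₁₁_pos hn hr.le (D.r₀_nonneg.trans_lt hr)).le

theorem k_eq_radMat' (hn : 3 ≤ n) (hx : D.r₀ < ‖x‖) :
    D.k x = radMat (D.kn ‖x‖ * √(D.g₁₁ ‖x‖) ^ 2) (D.kt ‖x‖ * (D.rho ‖x‖ / ‖x‖) ^ 2) x := by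
  rw [D.sqrt_sq_g₁₁ hn hx, D.k_eq_radMat hx.le (norm_pos_iff.1 (D.r₀_nonneg.trans_lt hx))]

theorem tr_k (hn : 3 ≤ n) (hx : D.r₀ < ‖x‖) :
    tr D.g D.k x = D.kn ‖x‖ + ((n : ℝ) - 1) * D.kt ‖x‖ := by
  have h := D.radialMetricAt hn hx
  rw [tr_radMat h.ne_zero h.sq_s_ne h.sq_rho_ne h.eq_radMat.self_of_nhds (D.k_eq_radMat' hn hx),
    mul_div_cancel_right₀ _ h.sq_s_ne, mul_div_cancel_right₀ _ h.sq_rho_ne]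

theorem normSq_k (hn : 3 ≤ n) (hx : D.r₀ < ‖x‖) :
    normSq D.g D.k x = D.kn ‖x‖ ^ 2 + ((n : ℝ) - 1) * D.kt ‖x‖ ^ 2 := by
  have h := D.radialMetricAt hn hx
  rw [normSq_radMat h.ne_zero h.sq_s_ne h.sq_rho_ne h.eq_radMat.self_of_nhds
    (D.k_eq_radMat' hn hx), mul_div_cancel_right₀ _ h.sq_s_ne, mul_div_cancel_right₀ _ h.sq_rho_ne]

theorem momentumTensor_eq (hn : 3 ≤ n) (hx : D.r₀ < ‖x‖) : D.momentumTensor x =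
    radMat (-(((n : ℝ) - 1) * D.kt ‖x‖) * √(D.g₁₁ ‖x‖) ^ 2)
      (-(D.kn ‖x‖ + ((n : ℝ) - 2) * D.kt ‖x‖) * (D.rho ‖x‖ / ‖x‖) ^ 2) x := by
  have h := D.radialMetricAt hn hx
  ext i j
  rw [InitialData.momentumTensor, D.tr_k hn hx, D.k_eq_radMat' hn hx, h.eq_radMat.self_of_nhds]
  simp only [Matrix.sub_apply, Matrix.smul_apply, radMat_apply, smul_eq_mul]
  ring

end

/-- The constraint equations. -/
theorem exists_sphericalConstraints (hn : 3 ≤ n) (hDEC : D.DominantEnergy)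
    (hun : ∀ r, D.r₀ < r → |D.shear r| < D.expansion r) :
    ∃ μ J, SphericalConstraints n D.r₀ (fun r => √(D.g₁₁ r)) D.rho D.expansion D.shear D.kn μ J := by
  obtain ⟨i₀, -, -⟩ := exists_ne hn
  have hn' : (3 : ℝ) ≤ n := by exact_mod_cast hn
  have hn1 : (0 : ℝ) < n - 1 := by linarith
  set e : ℝ → Space n := fun r => EuclideanSpace.single i₀ r
  have he : ∀ r, D.r₀ < r → ‖e r‖ = r := fun r hr =>
    norm_single_of_nonneg i₀ (D.r₀_nonneg.trans hr.le)
  have hg : ∀ r, D.r₀ < r → D.r₀ < ‖e r‖ := fun r hr => by rwa [he r hr]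
  have hs : ∀ r, D.r₀ < r → 0 < √(D.g₁₁ r) := fun r hr => by
    simpa only [he r hr] using (D.radialMetricAt hn (hg r hr)).s_pos
  have hρ : ∀ r, D.r₀ < r → 0 < D.rho r := fun r hr => by
    simpa only [he r hr] using (D.radialMetricAt hn (hg r hr)).rho_pos
  have hkt : ∀ r, D.r₀ < r → HasDerivAt D.kt (deriv D.kt r) r := fun r hr =>
    (hasDerivAt_of_contDiffOn_radii (D.contDiffOn_kt hn) hr).1
  have hkn : ∀ r, D.r₀ < r → HasDerivAt D.kn (deriv D.kn r) r := fun r hr =>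
    (hasDerivAt_of_contDiffOn_radii (D.contDiffOn_kn hn) hr).1
  -- Both densities are rescaled by `8π/(n-1)`, which preserves the dominant energy condition. `J`
  -- is chosen so that the equation for `Y'` holds identically; the divergence formula then
  -- identifies it with the momentum density (`h2` below).
  set μ : ℝ → ℝ := fun r => 8 * Real.pi * D.energyDensity (e r) / ((n : ℝ) - 1) with hμ
  set J : ℝ → ℝ := fun r => (-deriv D.kt r + √(D.g₁₁ r) * D.expansion r / D.rho r *
    (D.kn r - D.kt r)) / √(D.g₁₁ r) with hJ
  refine ⟨μ, J, hs, hρ, fun r hr => D.hasDerivAt_rho hn hr, fun r hr => ?_, fun r hr => ?_,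
    fun r hr => ?_, hun⟩
  · have h1 := (hasDerivAt_of_contDiffOn_radii (D.contDiffOn_expansion hn) hr).1
    refine h1.congr_deriv ?_
    have h2 := (D.radialMetricAt hn (hg r hr)).scalarCurvature_eq
    have hs := (hs r hr).ne'
    have hρ := (hρ r hr).ne'
    rw [hμ]
    simp only [InitialData.energyDensity, h2, D.tr_k hn (hg r hr), D.normSq_k hn (hg r hr), he r hr,
      shear]
    field_simp
    ring
  · have h1 := (D.hasDerivAt_rho hn hr).fun_mul (hkt r hr)
    refine h1.congr_deriv ?_
    have hs := (hs r hr).ne'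
    have hρ := (hρ r hr).ne'
    simp only [hJ]
    field_simp
    ring
  · have h1 := D.radialMetricAt hn (hg r hr)
    have h2 : ∀ i, D.momentumDensity (e r) i =
        ((n : ℝ) - 1) * √(D.g₁₁ r) * J r / (8 * Real.pi) * nu (e r) i := by
      intro i
      have h3 := h1.divergence_eq (S := D.momentumTensor)
        (P := fun r => -(((n : ℝ) - 1) * D.kt r))
        (Q := fun r => -(D.kn r + ((n : ℝ) - 2) * D.kt r)) (by
          filter_upwards [(isOpen_lt continuous_const continuous_norm).mem_nhds (hg r hr)] with y hy
          exact D.momentumTensor_eq hn hy)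
        (((hkt _ (hg r hr)).const_mul _).fun_neg)
        (((hkn _ (hg r hr)).fun_add ((hkt _ (hg r hr)).const_mul _)).fun_neg) i
      have hs := (hs r hr).ne'
      rw [InitialData.momentumDensity, h3]
      simp only [he r hr, hJ]
      field_simp
      ring
    have h4 := hDEC (e r) (InitialData.mem_inner_of_lt (hg r hr))
    rw [covectorNormSq_radMat h1.ne_zero h1.sq_s_ne h1.sq_rho_ne h1.eq_radMat.self_of_nhds _ h2,
      he r hr] at h4
    have h5 : (((n : ℝ) - 1) * √(D.g₁₁ r) * J r / (8 * Real.pi)) ^ 2 / √(D.g₁₁ r) ^ 2 =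
        (((n : ℝ) - 1) * J r / (8 * Real.pi)) ^ 2 := by
      have hs := (hs r hr).ne'
      field_simp
    rw [h5, Real.sqrt_sq_eq_abs, abs_div, abs_mul, abs_of_pos hn1,
      abs_of_pos (by positivity : 0 < 8 * Real.pi), div_le_iff₀ (by positivity)] at h4
    simp only [hμ]
    rw [le_div_iff₀ hn1]
    linarith

/-! ### Radial functions and Jang's equation -/

variable {D}

/-- The slope `φ' / √(g₁₁ + φ'²)` of a radial graph. -/
def slope (D : SphericalData n) (φ : ℝ → ℝ) (r : ℝ) : ℝ :=
  deriv φ r / √(D.g₁₁ r + deriv φ r ^ 2)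

theorem one_sub_slope_sq {φ : ℝ → ℝ} {r : ℝ} (hg : 0 < D.g₁₁ r) :
    1 - D.slope φ r ^ 2 = D.g₁₁ r / (D.g₁₁ r + deriv φ r ^ 2) := by
  have h : 0 < D.g₁₁ r + deriv φ r ^ 2 := by positivity
  rw [slope, div_pow, Real.sq_sqrt h.le]
  field_simp
  ring

theorem abs_slope_lt_one {φ : ℝ → ℝ} {r : ℝ} (hg : 0 < D.g₁₁ r) : |D.slope φ r| < 1 := by
  rw [← sq_lt_one_iff_abs_lt_one, ← sub_pos, one_sub_slope_sq hg]
  positivity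

theorem IsJangSolution.exists_radial (hn : 3 ≤ n) {f : Space n → ℝ} (hf : D.IsJangSolution f) :
    ∃ φ : ℝ → ℝ, (∀ x ∈ D.inner, f x = φ ‖x‖) ∧ ∀ r, D.r₀ < r →
      HasDerivAt φ (deriv φ r) r ∧ HasDerivAt (deriv φ) (deriv (deriv φ) r) r := by
  obtain ⟨i₀, -, -⟩ := exists_ne hn
  obtain ⟨φ, hφ⟩ := hf.radial
  refine ⟨φ, hφ, fun r hr => ?_⟩
  have h1 : ContDiffOn ℝ ∞ φ (Set.Ioi D.r₀) := by
    refine (hf.smooth.comp (contDiff_single i₀).contDiffOn (s := Set.Ioi D.r₀)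
      fun r hr => ?_).congr fun r hr => ?_
    · refine InitialData.mem_inner_of_lt ?_
      rwa [norm_single_of_nonneg i₀ (D.r₀_nonneg.trans (le_of_lt hr))]
    · have := norm_single_of_nonneg i₀ (D.r₀_nonneg.trans (le_of_lt hr))
      rw [Function.comp_apply, hφ _ (InitialData.mem_inner_of_lt (by rwa [this])), this]
  have h2 := h1.contDiffAt (Ioi_mem_nhds hr)
  exact ⟨(h2.differentiableAt (by simp)).hasDerivAt,
    ((h2.derivWithin (m := ∞) (by simp)).differentiableAt (by simp)).hasDerivAt⟩

section

variable {f : Space n → ℝ} {φ : ℝ → ℝ} {x : Space n}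

theorem pd_radial (hf : ∀ x ∈ D.inner, f x = φ ‖x‖)
    (hφ : ∀ r, D.r₀ < r → HasDerivAt φ (deriv φ r) r) (hx : D.r₀ < ‖x‖) (i : Fin n) :
    pd i f x = deriv φ ‖x‖ * nu x i := by
  have h0 := norm_pos_iff.1 (D.r₀_nonneg.trans_lt hx)
  refine ((hasPD_radial (hφ _ hx) h0).congr_of_eventuallyEq ?_).2 i
  filter_upwards [(isOpen_lt continuous_const continuous_norm).mem_nhds hx] with y hy
  exact hf y (InitialData.mem_inner_of_lt hy)

theorem jangMetric_eq (hf : ∀ x ∈ D.inner, f x = φ ‖x‖)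
    (hφ : ∀ r, D.r₀ < r → HasDerivAt φ (deriv φ r) r) (hx : D.r₀ < ‖x‖) :
    D.jangMetric f x =
      radMat (D.g₁₁ ‖x‖ + deriv φ ‖x‖ ^ 2) ((D.rho ‖x‖ / ‖x‖) ^ 2) x := by
  ext i j
  simp only [InitialData.jangMetric, Matrix.of_apply, pd_radial hf hφ hx,
    D.g_eq_radMat hx.le (norm_pos_iff.1 (D.r₀_nonneg.trans_lt hx)), radMat_apply]
  ring

theorem secondFormDiff_eq (hn : 3 ≤ n) (hf : ∀ x ∈ D.inner, f x = φ ‖x‖)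
    (hφ : ∀ r, D.r₀ < r → HasDerivAt φ (deriv φ r) r ∧
      HasDerivAt (deriv φ) (deriv (deriv φ) r) r) (hx : D.r₀ < ‖x‖) :
    D.secondFormDiff f x = radMat
      ((deriv (deriv φ) ‖x‖ - deriv (fun r => √(D.g₁₁ r)) ‖x‖ / √(D.g₁₁ ‖x‖) * deriv φ ‖x‖) *
        (√(D.g₁₁ ‖x‖) / √(D.g₁₁ ‖x‖ + deriv φ ‖x‖ ^ 2)) - D.kn ‖x‖ * D.g₁₁ ‖x‖)
      ((D.expansion ‖x‖ * D.slope φ ‖x‖ - D.shear ‖x‖) / D.rho ‖x‖ * (D.rho ‖x‖ / ‖x‖) ^ 2) x := by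
  have h := D.radialMetricAt hn hx
  have h0 := h.norm_pos
  have hg := D.g₁₁_pos hn hx.le h0
  have hs := h.s_pos
  have hρ := h.rho_pos
  have hcov : covectorNormSq D.g (fun a => pd a f x) x = deriv φ ‖x‖ ^ 2 / D.g₁₁ ‖x‖ := by
    rw [← D.sqrt_sq_g₁₁ hn hx]
    exact covectorNormSq_radMat h.ne_zero h.sq_s_ne h.sq_rho_ne h.eq_radMat.self_of_nhds _
      (pd_radial hf (fun r hr => (hφ r hr).1) hx)
  have hsq : √(1 + deriv φ ‖x‖ ^ 2 / D.g₁₁ ‖x‖) =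
      √(D.g₁₁ ‖x‖ + deriv φ ‖x‖ ^ 2) / √(D.g₁₁ ‖x‖) := by
    rw [← Real.sqrt_div (by positivity), add_div, div_self hg.ne']
  have hσ : 0 < √(D.g₁₁ ‖x‖ + deriv φ ‖x‖ ^ 2) := Real.sqrt_pos.2 (by positivity)
  have hhess := h.hessian_eq (f := f) (φ := φ) (φ' := deriv φ)
    (by filter_upwards [(isOpen_lt continuous_const continuous_norm).mem_nhds hx] with y hy
        exact hf y (InitialData.mem_inner_of_lt hy))
    (by filter_upwards [lt_mem_nhds hx] with r hr using (hφ r hr).1) (hφ _ hx).2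
  ext i j
  rw [InitialData.secondFormDiff, Matrix.sub_apply, InitialData.graphSecondForm, Matrix.of_apply,
    hhess, hcov, hsq, D.k_eq_radMat hx.le h.ne_zero]
  simp only [radMat_apply, slope, shear]
  field_simp
  ring

/-- The vanishing trace, split into eigenvalues. It replaces the only second derivative of `φ` by
first-order quantities. -/
theorem isJangSolution_radial_eq (hn : 3 ≤ n) (hJ : D.IsJangSolution f)
    (hf : ∀ x ∈ D.inner, f x = φ ‖x‖) (hφ : ∀ r, D.r₀ < r → HasDerivAt φ (deriv φ r) r ∧
      HasDerivAt (deriv φ) (deriv (deriv φ) r) r) (hx : D.r₀ < ‖x‖) :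
    ((deriv (deriv φ) ‖x‖ - deriv (fun r => √(D.g₁₁ r)) ‖x‖ / √(D.g₁₁ ‖x‖) * deriv φ ‖x‖) *
        (√(D.g₁₁ ‖x‖) / √(D.g₁₁ ‖x‖ + deriv φ ‖x‖ ^ 2)) - D.kn ‖x‖ * D.g₁₁ ‖x‖) /
        (D.g₁₁ ‖x‖ + deriv φ ‖x‖ ^ 2) =
      -(((n : ℝ) - 1) * ((D.expansion ‖x‖ * D.slope φ ‖x‖ - D.shear ‖x‖) / D.rho ‖x‖)) := by
  have h := D.radialMetricAt hn hx
  have hg := D.g₁₁_pos hn hx.le h.norm_pos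
  have h1 := hJ.jang x (InitialData.mem_inner_of_lt hx)
  rw [tr_radMat h.ne_zero (by positivity) h.sq_rho_ne
    (jangMetric_eq hf (fun r hr => (hφ r hr).1) hx) (secondFormDiff_eq hn hf hφ hx),
    mul_div_cancel_right₀ _ h.sq_rho_ne] at h1
  linarith

/-- The length of `h - k`. -/
theorem normSq_secondFormDiff (hn : 3 ≤ n) (hJ : D.IsJangSolution f)
    (hf : ∀ x ∈ D.inner, f x = φ ‖x‖) (hφ : ∀ r, D.r₀ < r → HasDerivAt φ (deriv φ r) r ∧
      HasDerivAt (deriv φ) (deriv (deriv φ) r) r) (hx : D.r₀ < ‖x‖) :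
    normSq (D.jangMetric f) (D.secondFormDiff f) x = (n : ℝ) * ((n : ℝ) - 1) *
      ((D.expansion ‖x‖ * D.slope φ ‖x‖ - D.shear ‖x‖) / D.rho ‖x‖) ^ 2 := by
  have h := D.radialMetricAt hn hx
  have hg := D.g₁₁_pos hn hx.le h.norm_pos
  -- With tangential eigenvalue `λ` and radial eigenvalue `-(n-1) λ`, the squared length is `(n-1)²
  -- λ² + (n-1) λ² = n(n-1) λ²`.
  rw [normSq_radMat h.ne_zero (by positivity) h.sq_rho_ne
    (jangMetric_eq hf (fun r hr => (hφ r hr).1) hx) (secondFormDiff_eq hn hf hφ hx),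
    isJangSolution_radial_eq hn hJ hf hφ hx, mul_div_cancel_right₀ _ h.sq_rho_ne]
  ring

/-- The derivative of the slope by `g`-arclength is exactly the radial eigenvalue of `h` with
respect to `ḡ`, while that of `k` is `(1 - v²) kₙ`. Jang's equation expresses their difference
through the tangential eigenvalue. -/
theorem jangODE (hn : 3 ≤ n) (hJ : D.IsJangSolution f)
    (hf : ∀ x ∈ D.inner, f x = φ ‖x‖) (hφ : ∀ r, D.r₀ < r → HasDerivAt φ (deriv φ r) r ∧
      HasDerivAt (deriv φ) (deriv (deriv φ) r) r) :
    SphericalConstraints.JangODE n D.r₀ (fun r => √(D.g₁₁ r)) D.rho D.expansion D.shear D.kn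
      (D.slope φ) := by
  intro r hr
  obtain ⟨i₀, -, -⟩ := exists_ne hn
  have hg := D.g₁₁_pos hn hr.le (D.r₀_nonneg.trans_lt hr)
  refine ⟨abs_slope_lt_one hg, ?_⟩
  have he := norm_single_of_nonneg i₀ (D.r₀_nonneg.trans hr.le)
  have h1 := isJangSolution_radial_eq hn hJ hf hφ (x := EuclideanSpace.single i₀ r) (by rwa [he])
  rw [he] at h1
  have hg' := (hasDerivAt_of_contDiffOn_radii (D.contDiffOn_sqrt_g₁₁ hn) hr).1
  have hσ0 : 0 < D.g₁₁ r + deriv φ r ^ 2 := by positivity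
  have hsq := D.sqrt_sq_g₁₁ hn hr
  have hg'' : HasDerivAt D.g₁₁ (2 * √(D.g₁₁ r) * deriv (fun r => √(D.g₁₁ r)) r) r := by
    refine ((hg'.fun_pow 2).congr_of_eventuallyEq ?_).congr_deriv (by norm_num)
    filter_upwards [lt_mem_nhds hr] with t ht using (D.sqrt_sq_g₁₁ hn ht).symm
  have h2 := (hφ r hr).2.fun_div ((hg''.fun_add ((hφ r hr).2.fun_pow 2)).sqrt hσ0.ne')
    (Real.sqrt_pos.2 hσ0).ne'
  refine h2.congr_deriv ?_
  have h3 : -(((n : ℝ) - 1) * (D.expansion r * D.slope φ r - D.shear r) / D.rho r) =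
    -(((n : ℝ) - 1) * ((D.expansion r * D.slope φ r - D.shear r) / D.rho r)) := by ring
  rw [one_sub_slope_sq hg, sub_eq_add_neg _ (_ / _), h3, ← h1]
  set q := √(D.g₁₁ r + deriv φ r ^ 2) with hq
  have hq2 : q ^ 2 = D.g₁₁ r + deriv φ r ^ 2 := Real.sq_sqrt hσ0.le
  have hq0 : 0 < q := Real.sqrt_pos.2 hσ0
  set s := √(D.g₁₁ r) with hs
  have hs0 : 0 < s := Real.sqrt_pos.2 hg
  rw [← hq2]
  have hgs : D.g₁₁ r = s ^ 2 := hsq.symm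
  have hq3 : q ^ 2 = s ^ 2 + deriv φ r ^ 2 := by rw [hq2, hgs]
  rw [hgs]
  field_simp
  push_cast
  rw [hq3]
  ring

end

end SphericalData

/-! ### Integrals over coordinate spheres -/

/-- The sphere measure of a set is defined by the volume of the cone over it, and Lebesgue measure
is invariant under `x ↦ -x`. -/
theorem measurePreserving_neg_toSphere (n : ℕ) :
    MeasurePreserving (fun ν : Metric.sphere (0 : Space n) 1 => -ν)
      (volume : Measure (Space n)).toSphere (volume : Measure (Space n)).toSphere := by
  have hm : Measurable (fun ν : Metric.sphere (0 : Space n) 1 => -ν) := continuous_neg.measurable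
  refine ⟨hm, Measure.ext fun s hs => ?_⟩
  rw [Measure.map_apply hm hs, Measure.toSphere_apply' _ hs, Measure.toSphere_apply' _ (hm hs),
    ← Measure.measure_neg volume]
  congr 2
  ext y
  simp only [Set.mem_neg, Set.mem_smul, Set.mem_image, Set.mem_preimage]
  constructor
  · rintro ⟨t, ht, w, ⟨ν, hν, rfl⟩, hy⟩
    exact ⟨t, ht, _, ⟨-ν, hν, rfl⟩, by
      rw [← neg_neg y, ← hy]; simp⟩
  · rintro ⟨t, ht, w, ⟨ν, hν, rfl⟩, hy⟩
    exact ⟨t, ht, _, ⟨-ν, by simpa using hν, rfl⟩, by rw [← hy]; simp⟩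

theorem integral_coord_toSphere (n : ℕ) (i : Fin n) :
    ∫ ν : Metric.sphere (0 : Space n) 1, (ν : Space n) i
      ∂(volume : Measure (Space n)).toSphere = 0 := by
  have h := (measurePreserving_neg_toSphere n).integral_comp
    (Homeomorph.neg (Metric.sphere (0 : Space n) 1)).measurableEmbedding
    (fun ν : Metric.sphere (0 : Space n) 1 => (ν : Space n) i)
  have h2 : ∀ ν : Metric.sphere (0 : Space n) 1, ((-ν : Metric.sphere (0 : Space n) 1) : Space n) i
    = -((ν : Space n) i) := fun ν => by simp
  simp_rw [h2, integral_neg] at h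
  linarith

theorem sphereVolume_pos {n : ℕ} (hn : 3 ≤ n) : 0 < sphereVolume n := by
  have : Nonempty (Fin n) := ⟨⟨0, by omega⟩⟩
  have : Nontrivial (Space n) := inferInstance
  exact ENNReal.toReal_pos (by rw [Measure.measure_univ_ne_zero]; exact Measure.toSphere_ne_zero _)
    (measure_ne_top _ _)

theorem norm_smul_sphere {n : ℕ} {r : ℝ} (hr : 0 < r) (ν : Metric.sphere (0 : Space n) 1) :
    ‖r • (ν : Space n)‖ = r := by
  rw [norm_smul, norm_eq_of_mem_sphere, mul_one, Real.norm_eq_abs, abs_of_pos hr]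

theorem sphereIntegral_const {n : ℕ} {F : Space n → ℝ} {r c : ℝ} (hr : 0 < r)
    (hF : ∀ x, ‖x‖ = r → F x = c) : sphereIntegral F r = r ^ (n - 1) * (c * sphereVolume n) := by
  rw [sphereIntegral]
  simp_rw [fun ν : Metric.sphere (0 : Space n) 1 => hF _ (norm_smul_sphere hr ν)]
  rw [integral_const, smul_eq_mul, mul_comm c]
  rfl

theorem sphereIntegral_nu {n : ℕ} {F : Space n → ℝ} {r c : ℝ} (hr : 0 < r) (i : Fin n)
    (hF : ∀ x, ‖x‖ = r → F x = c * nu x i) : sphereIntegral F r = 0 := by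
  rw [sphereIntegral]
  have : ∀ ν : Metric.sphere (0 : Space n) 1, F (r • (ν : Space n)) = c * (ν : Space n) i := by
    intro ν
    rw [hF _ (norm_smul_sphere hr ν), nu, norm_smul_sphere hr ν]
    simp only [PiLp.smul_apply, smul_eq_mul]
    field_simp
  simp_rw [this]
  rw [integral_const_mul, integral_coord_toSphere]
  ring

namespace SphericalData

variable {n : ℕ} (D : SphericalData n)

/-! ### The ADM mass -/

/-- The derivative of `(ρ / r)²`. -/
theorem hasDerivAt_sq_rho_div (hn : 3 ≤ n) {r : ℝ} (hr : D.r₀ < r) :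
    HasDerivAt (fun r => (D.rho r / r) ^ 2)
      (2 * (D.rho r / r) * (√(D.g₁₁ r) * D.expansion r - D.rho r / r) / r) r := by
  have h0 : r ≠ 0 := (D.r₀_nonneg.trans_lt hr).ne'
  refine (((D.hasDerivAt_rho hn hr).fun_div (hasDerivAt_id r) h0).fun_pow 2).congr_deriv ?_
  simp only [id]
  push_cast
  field_simp

theorem pd_g (hn : 3 ≤ n) {x : Space n} (hx : D.r₀ < ‖x‖) (l i j : Fin n) :
    pd l (fun y => D.g y i j) x = nu x l * (deriv D.g₁₁ ‖x‖ * (nu x i * nu x j) +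
      (2 * (D.rho ‖x‖ / ‖x‖) * (√(D.g₁₁ ‖x‖) * D.expansion ‖x‖ - D.rho ‖x‖ / ‖x‖) / ‖x‖) *
        tang x i j) + (D.g₁₁ ‖x‖ - (D.rho ‖x‖ / ‖x‖) ^ 2) / ‖x‖ *
          (tang x i l * nu x j + nu x i * tang x j l) := by
  have h0 := D.r₀_nonneg.trans_lt hx
  refine pd_of_eventuallyEq_radMat (T := fun r => (D.rho r / r) ^ 2) (norm_pos_iff.1 h0) ?_
    (hasDerivAt_of_contDiffOn_radii (D.contDiffOn_g₁₁ hn) hx).1 (D.hasDerivAt_sq_rho_div hn hx) l i j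
  filter_upwards [(isOpen_lt continuous_const continuous_norm).mem_nhds hx] with y hy
  exact D.g_eq_radMat (le_of_lt hy) (norm_pos_iff.1 (D.r₀_nonneg.trans_lt hy))

/-- The integrand is constant on the sphere. The derivative of `g₁₁` cancels between `∂ᵢgᵢⱼ` and
`∂ⱼgᵢᵢ`, leaving the turning term and the derivative of `(ρ/r)²`. -/
theorem energyFlux_eq (hn : 3 ≤ n) {r : ℝ} (hr : D.r₀ < r) :
    D.energyFlux r = r ^ (n - 1) / 2 * ((D.g₁₁ r - (D.rho r / r) ^ 2) / r -
      2 * (D.rho r / r) * (√(D.g₁₁ r) * D.expansion r - D.rho r / r) / r) := by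
  have h0 := D.r₀_nonneg.trans_lt hr
  have hn' : (3 : ℝ) ≤ n := by exact_mod_cast hn
  have hn1 : (n : ℝ) - 1 ≠ 0 := by linarith
  rw [InitialData.energyFlux, sphereIntegral_const (c := ((n : ℝ) - 1) *
    ((D.g₁₁ r - (D.rho r / r) ^ 2) / r -
      2 * (D.rho r / r) * (√(D.g₁₁ r) * D.expansion r - D.rho r / r) / r)) h0]
  · have := (sphereVolume_pos hn).ne'
    field_simp
  · intro x hx
    have hx0 : x ≠ 0 := norm_pos_iff.1 (hx ▸ h0)
    simp_rw [D.pd_g hn (hx ▸ hr : D.r₀ < ‖x‖), hx]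
    set c' := 2 * (D.rho r / r) * (√(D.g₁₁ r) * D.expansion r - D.rho r / r) / r
    set K := (D.g₁₁ r - (D.rho r / r) ^ 2) / r
    have h1 : ∀ i, ∑ j, (nu x i * (deriv D.g₁₁ r * (nu x i * nu x j) + c' * tang x i j) +
        K * (tang x i i * nu x j + nu x i * tang x j i) -
        (nu x j * (deriv D.g₁₁ r * (nu x i * nu x i) + c' * tang x i i) +
          K * (tang x i j * nu x i + nu x i * tang x i j))) * (x j / r) =
        (K - c') * tang x i i := by
      intro i
      have h2 : ∀ j, (nu x i * (deriv D.g₁₁ r * (nu x i * nu x j) + c' * tang x i j) +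
        K * (tang x i i * nu x j + nu x i * tang x j i) -
        (nu x j * (deriv D.g₁₁ r * (nu x i * nu x i) + c' * tang x i i) +
          K * (tang x i j * nu x i + nu x i * tang x i j))) * (x j / r) =
          ((K - c') * tang x i i) * (nu x j * nu x j) +
          (c' - K) * nu x i * (tang x i j * nu x j) := fun j => by
        have : x j / r = nu x j := by rw [nu, hx]
        rw [this, tang_comm x j i]
        ring
      simp_rw [h2, Finset.sum_add_distrib, ← Finset.mul_sum, sum_nu_mul_nu hx0,
        sum_tang_mul_nu hx0]
      ring
    simp_rw [h1, ← Finset.mul_sum, sum_tang hx0]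
    ring

/-- The normal is an eigenvector of the momentum tensor, so the integrand is a constant multiple of
`νᵢ`, an odd function. -/
theorem momentumFlux_eq_zero (hn : 3 ≤ n) {r : ℝ} (hr : D.r₀ < r) (i : Fin n) :
    D.momentumFlux i r = 0 := by
  have h0 := D.r₀_nonneg.trans_lt hr
  rw [InitialData.momentumFlux, sphereIntegral_nu (c := -(((n : ℝ) - 1) * D.kt r) *
    √(D.g₁₁ r) ^ 2) h0 i, mul_zero]
  intro x hx
  have hx0 : x ≠ 0 := norm_pos_iff.1 (hx ▸ h0)
  rw [D.momentumTensor_eq hn (hx ▸ hr : D.r₀ < ‖x‖)]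
  have := sum_radMat_mul_nu hx0 (-(((n : ℝ) - 1) * D.kt ‖x‖) * √(D.g₁₁ ‖x‖) ^ 2)
      (-(D.kn ‖x‖ + ((n : ℝ) - 2) * D.kt ‖x‖) * (D.rho ‖x‖ / ‖x‖) ^ 2) i
  rw [← hx, ← this]
  rfl

/-- The ADM mass is the absolute value of the limit of the energy flux. -/
theorem HasADMMass.tendsto_energyFlux (hn : 3 ≤ n) {m : ℝ} (hm : D.HasADMMass m) :
    ∃ E, Tendsto D.energyFlux atTop (𝓝 E) ∧ m = |E| := by
  obtain ⟨E, P, hE, hP, rfl⟩ := hm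
  refine ⟨E, hE, ?_⟩
  have h0 : ∀ i, P i = 0 := fun i => by
    refine tendsto_nhds_unique (hP i) (tendsto_const_nhds.congr' ?_)
    filter_upwards [eventually_gt_atTop D.r₀] with r hr using (D.momentumFlux_eq_zero hn hr i).symm
  simp [h0, Real.sqrt_sq_eq_abs]

/-! ### Asymptotics -/

section Asymptotics

variable {D} {ρ₀ C : ℝ}

theorem tendsto_of_abs_le_div {F : ℝ → ℝ} {k : ℕ} (hk : k ≠ 0)
    (hF : ∀ᶠ r in atTop, |F r| ≤ C / r ^ k) : Tendsto F atTop (𝓝 0) :=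
  squeeze_zero_norm' (hF.mono fun r hr => by rwa [Real.norm_eq_abs])
    (tendsto_const_nhds.div_atTop (tendsto_pow_atTop hk))

theorem tendsto_g₁₁ (hn : 3 ≤ n) (h : D.AsymptoticallyFlat ρ₀ C) :
    Tendsto D.g₁₁ atTop (𝓝 1) := by
  obtain ⟨i, j, hij⟩ := exists_ne hn
  rw [← tendsto_sub_nhds_zero_iff]
  refine tendsto_of_abs_le_div (C := C) (k := n - 2) (by omega) ?_
  filter_upwards [eventually_gt_atTop ρ₀, eventually_gt_atTop 0] with r hr h0
  have he := norm_single_of_nonneg i h0.le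
  have h1 := h.g_decay₀ (EuclideanSpace.single i r) (by rwa [he]) i i
  rw [he, Matrix.one_apply_eq] at h1
  rwa [← D.rayComp_g_self i (h.r₀_le.trans hr.le) h0]

theorem tendsto_rho_div_sq (hn : 3 ≤ n) (h : D.AsymptoticallyFlat ρ₀ C) :
    Tendsto (fun r => (D.rho r / r) ^ 2) atTop (𝓝 1) := by
  obtain ⟨i, j, hij⟩ := exists_ne hn
  rw [← tendsto_sub_nhds_zero_iff]
  refine tendsto_of_abs_le_div (C := C) (k := n - 2) (by omega) ?_
  filter_upwards [eventually_gt_atTop ρ₀, eventually_gt_atTop 0] with r hr h0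
  have he := norm_single_of_nonneg i h0.le
  have h1 := h.g_decay₀ (EuclideanSpace.single i r) (by rwa [he]) j j
  rw [he, Matrix.one_apply_eq] at h1
  rwa [← D.rayComp_g_ne hij (h.r₀_le.trans hr.le) h0]

theorem tendsto_rho_div (hn : 3 ≤ n) (h : D.AsymptoticallyFlat ρ₀ C) :
    Tendsto (fun r => D.rho r / r) atTop (𝓝 1) := by
  have h1 := (tendsto_rho_div_sq hn h).sqrt
  rw [Real.sqrt_one] at h1
  refine h1.congr' ?_
  filter_upwards [eventually_ge_atTop D.r₀, eventually_gt_atTop 0] with r hr h0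
  exact Real.sqrt_sq (div_pos (D.rho_pos r hr h0) h0).le

/-- The quantity is the derivative of `(ρ/r)²`, that is, the radial derivative of a transverse
component of `g`. -/
theorem tendsto_deriv_rho_div (hn : 3 ≤ n) (h : D.AsymptoticallyFlat ρ₀ C) :
    ∀ᶠ r in atTop, |2 * (D.rho r / r) * (√(D.g₁₁ r) * D.expansion r - D.rho r / r) / r| ≤
      C / r ^ (n - 1) := by
  obtain ⟨i, j, hij⟩ := exists_ne hn
  filter_upwards [eventually_gt_atTop ρ₀, eventually_gt_atTop 0] with r hr h0
  have he := norm_single_of_nonneg i h0.le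
  have h1 := h.g_decay₁ (EuclideanSpace.single i r) (by rwa [he]) j j i
  rw [D.pd_g hn (by rw [he]; exact h.r₀_le.trans_lt hr), he] at h1
  simp only [nu_single i _ h0, tang, Matrix.one_apply_eq, Matrix.one_apply_ne hij,
    Matrix.one_apply_ne hij.symm] at h1
  rw [show n - 2 + 1 = n - 1 by omega] at h1
  refine le_of_eq_of_le (congrArg _ ?_) h1
  ring

theorem abs_kt_mul_le (hn : 3 ≤ n) (h : D.AsymptoticallyFlat ρ₀ C) :
    ∀ᶠ r in atTop, |D.kt r * (D.rho r / r) ^ 2| ≤ C / r ^ (n - 1) := by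
  obtain ⟨i, j, hij⟩ := exists_ne hn
  filter_upwards [eventually_gt_atTop ρ₀, eventually_gt_atTop 0] with r hr h0
  have he := norm_single_of_nonneg i h0.le
  have h1 := h.k_decay₀ (EuclideanSpace.single i r) (by rwa [he]) j j
  rw [he] at h1
  rwa [← D.rayComp_k_ne hij (h.r₀_le.trans hr.le) h0]

/-- A quantity of order `r^(1-n)` is negligible when squared and multiplied by `r^n`. -/
theorem tendsto_pow_mul_sq (hn : 3 ≤ n) {F : ℝ → ℝ} (hF : ∀ᶠ r in atTop, |F r| ≤ C / r ^ (n - 1)) :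
    Tendsto (fun r => r ^ n * F r ^ 2) atTop (𝓝 0) := by
  refine tendsto_of_abs_le_div (C := C ^ 2) (k := n - 2) (by omega) ?_
  filter_upwards [hF, eventually_gt_atTop 0] with r hr h0
  rw [abs_of_nonneg (by positivity), ← sq_abs (F r)]
  have h1 : |F r| ^ 2 ≤ (C / r ^ (n - 1)) ^ 2 := pow_le_pow_left₀ (abs_nonneg _) hr 2
  refine (mul_le_mul_of_nonneg_left h1 (by positivity)).trans_eq ?_
  obtain ⟨k, rfl⟩ : ∃ k, n = k + 2 := ⟨n - 2, by omega⟩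
  rw [show k + 2 - 1 = k + 1 by omega, Nat.add_sub_cancel]
  field_simp
  ring

theorem tendsto_mul_of_abs_le (hn : 3 ≤ n) {F : ℝ → ℝ}
    (hF : ∀ᶠ r in atTop, |F r| ≤ C / r ^ (n - 1)) : Tendsto (fun r => r * F r) atTop (𝓝 0) := by
  refine tendsto_of_abs_le_div (C := C) (k := n - 2) (by omega) ?_
  filter_upwards [hF, eventually_gt_atTop 0] with r hr h0
  rw [abs_mul, abs_of_pos h0]
  refine (mul_le_mul_of_nonneg_left hr h0.le).trans_eq ?_
  obtain ⟨k, rfl⟩ : ∃ k, n = k + 2 := ⟨n - 2, by omega⟩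
  rw [show k + 2 - 1 = k + 1 by omega, Nat.add_sub_cancel]
  field_simp
  ring

/-- Writes `ρ' = √g₁₁ X` through `ρ/r` and the derivative of `(ρ/r)²`, whose limits are known. -/
theorem sqrt_g₁₁_mul_expansion {r : ℝ} (hr : D.r₀ ≤ r) (h0 : 0 < r) :
    √(D.g₁₁ r) * D.expansion r = D.rho r / r + r * (2 * (D.rho r / r) *
      (√(D.g₁₁ r) * D.expansion r - D.rho r / r) / r) / (2 * (D.rho r / r)) := by
  have hρ := (D.rho_pos r hr h0).ne'
  field_simp
  ring

theorem tendsto_expansion (hn : 3 ≤ n) (h : D.AsymptoticallyFlat ρ₀ C) :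
    Tendsto D.expansion atTop (𝓝 1) := by
  have hu := tendsto_rho_div hn h
  have h1 := ((hu.add ((tendsto_mul_of_abs_le hn (tendsto_deriv_rho_div hn h)).div
    (hu.const_mul 2) (by norm_num))).div (tendsto_g₁₁ hn h).sqrt (by simp))
  have h2 : (1 + 0 / (2 * 1)) / √1 = (1 : ℝ) := by simp
  rw [h2] at h1
  refine h1.congr' ?_
  filter_upwards [eventually_ge_atTop D.r₀, eventually_gt_atTop 0] with r hr h0
  simp only [Pi.div_apply]
  rw [← sqrt_g₁₁_mul_expansion hr h0,
    mul_div_cancel_left₀ _ (Real.sqrt_pos.2 (D.g₁₁_pos hn hr h0)).ne']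

theorem shear_eq {r : ℝ} (hr : D.r₀ ≤ r) (h0 : 0 < r) :
    D.shear r = r * (D.kt r * (D.rho r / r) ^ 2) / (D.rho r / r) := by
  have hρ := (D.rho_pos r hr h0).ne'
  rw [shear]
  field_simp

theorem tendsto_shear (hn : 3 ≤ n) (h : D.AsymptoticallyFlat ρ₀ C) :
    Tendsto D.shear atTop (𝓝 0) := by
  have h1 := (tendsto_mul_of_abs_le hn (abs_kt_mul_le hn h)).div (tendsto_rho_div hn h) one_ne_zero
  rw [zero_div] at h1
  refine h1.congr' ?_
  filter_upwards [eventually_ge_atTop D.r₀, eventually_gt_atTop 0] with r hr h0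
  exact (shear_eq hr h0).symm

/-- The Misner–Sharp mass converges to the ADM energy. -/
theorem tendsto_misnerSharp (hn : 3 ≤ n) (h : D.AsymptoticallyFlat ρ₀ C) {E : ℝ}
    (hE : Tendsto D.energyFlux atTop (𝓝 E)) :
    Tendsto (misnerSharp n D.rho D.expansion D.shear) atTop (𝓝 E) := by
  have hu := tendsto_rho_div hn h
  have ha := tendsto_g₁₁ hn h
  have h1 := tendsto_pow_mul_sq hn (tendsto_deriv_rho_div hn h)
  have h2 := tendsto_pow_mul_sq hn (abs_kt_mul_le hn h)
  -- With `u = ρ/r` and `c = ((ρ/r)²)'`, the mass is exactly `uⁿ⁻² flux/g₁₁ + ½ uⁿ⁻² (rⁿ (kₜ u²)²/u²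
  -- - rⁿ c²/(4 u² g₁₁))`. The second summand is quadratic in quantities of order `r^(1-n)` and
  -- vanishes in the limit.
  have h3 := (((hu.pow (n - 2)).mul hE).div ha one_ne_zero).add (((hu.pow (n - 2)).div_const 2).mul
    ((h2.div (hu.pow 2) (by norm_num)).sub
      (h1.div (((hu.pow 2).const_mul 4).mul ha) (by norm_num))))
  have h4 : 1 ^ (n - 2) * E / 1 + 1 ^ (n - 2) / 2 * (0 / 1 ^ 2 - 0 / (4 * 1 ^ 2 * 1)) = E := by simp
  rw [h4] at h3
  refine h3.congr' ?_
  filter_upwards [eventually_gt_atTop D.r₀, eventually_gt_atTop 0] with r hr h0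
  have hρ := (D.rho_pos r hr.le h0).ne'
  have hg := D.g₁₁_pos hn hr.le h0
  simp only [Pi.div_apply]
  rw [D.energyFlux_eq hn hr, misnerSharp, shear]
  set s := √(D.g₁₁ r) with hs
  have hs0 : s ≠ 0 := (Real.sqrt_pos.2 hg).ne'
  rw [← D.sqrt_sq_g₁₁ hn hr, ← hs]
  obtain ⟨k, rfl⟩ : ∃ k, n = k + 2 := ⟨n - 2, by omega⟩
  rw [show k + 2 - 1 = k + 1 by omega, Nat.add_sub_cancel]
  simp only [div_pow]
  field_simp
  ring

end Asymptotics

variable {D}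

/-! ### The horizon condition -/

theorem thetaPlus_eq {r : ℝ} (hr : D.r₀ ≤ r) (h0 : 0 < r) :
    D.thetaPlus r = ((n : ℝ) - 1) * (D.expansion r + D.shear r) / D.rho r := by
  have hρ := (D.rho_pos r hr h0).ne'
  rw [thetaPlus, meanCurvature, expansion, shear, ← div_div]
  field_simp

theorem thetaMinus_eq {r : ℝ} (hr : D.r₀ ≤ r) (h0 : 0 < r) :
    D.thetaMinus r = ((n : ℝ) - 1) * (D.expansion r - D.shear r) / D.rho r := by
  have hρ := (D.rho_pos r hr h0).ne'
  rw [thetaMinus, meanCurvature, expansion, shear, ← div_div]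
  field_simp

theorem pos_of_ne_zero_of_tendsto {F : ℝ → ℝ} {r₀ : ℝ} (hc : ContinuousOn F (Set.Ioi r₀))
    (h0 : ∀ r, r₀ < r → F r ≠ 0) (h1 : Tendsto F atTop (𝓝 1)) {r : ℝ} (hr : r₀ < r) :
    0 < F r := by
  by_contra! hle
  obtain ⟨t, ht, htr⟩ := ((h1.eventually (lt_mem_nhds zero_lt_one)).and
    (eventually_ge_atTop r)).exists
  obtain ⟨z, hz, hz0⟩ := intermediate_value_Icc htr
    (hc.mono fun y hy => hr.trans_le hy.1) ⟨hle, ht.le⟩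
  exact h0 z (hr.trans_le hz.1) hz0

/-- `X + Y` and `X - Y` are positive multiples of `θ₊` and `θ₋`: they have no zero outside `r₀` and
tend to `1`, so they are positive by the intermediate value theorem. -/
theorem abs_shear_lt_expansion (hn : 3 ≤ n) {ρ₀ C : ℝ} (h : D.AsymptoticallyFlat ρ₀ C)
    (hHor : D.OutermostHorizonOrNoBoundary) {r : ℝ} (hr : D.r₀ < r) :
    |D.shear r| < D.expansion r := by
  have hsub : Set.Ioi D.r₀ ⊆ D.radii := fun r hr => ⟨(Set.mem_Ioi.1 hr).le, D.r₀_nonneg.trans_lt hr⟩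
  have hX := (D.contDiffOn_expansion hn).continuousOn.mono hsub
  have hY := (D.contDiffOn_shear hn).continuousOn.mono hsub
  have hX1 := tendsto_expansion hn h
  have hY1 := tendsto_shear hn h
  have h1 : 0 < D.expansion r + D.shear r :=
    pos_of_ne_zero_of_tendsto (F := fun r => D.expansion r + D.shear r) (hX.add hY)
      (fun r hr h0 => (hHor.2 r hr).1 (by
      rw [thetaPlus_eq hr.le (D.r₀_nonneg.trans_lt hr), show D.expansion r + D.shear r = 0 from h0]
      simp)) (by simpa using hX1.add hY1) hr
  have h2 : 0 < D.expansion r - D.shear r :=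
    pos_of_ne_zero_of_tendsto (F := fun r => D.expansion r - D.shear r) (hX.sub hY)
      (fun r hr h0 => (hHor.2 r hr).2 (by
      rw [thetaMinus_eq hr.le (D.r₀_nonneg.trans_lt hr), show D.expansion r - D.shear r = 0 from h0]
      simp)) (by simpa using hX1.sub hY1) hr
  rw [abs_lt]
  constructor <;> linarith

theorem abs_shear_eq_of_horizon (hn : 3 ≤ n) (h0 : 0 < D.r₀)
    (hHor : D.OutermostHorizonOrNoBoundary) : D.shear D.r₀ ^ 2 = D.expansion D.r₀ ^ 2 := by
  have hρ := (D.rho_pos D.r₀ le_rfl h0).ne'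
  have hn' : (3 : ℝ) ≤ n := by exact_mod_cast hn
  have hn1 : (n : ℝ) - 1 ≠ 0 := by linarith
  rcases hHor.1 h0 with h | h
  · rw [thetaPlus_eq le_rfl h0, div_eq_zero_iff, mul_eq_zero] at h
    have : D.expansion D.r₀ + D.shear D.r₀ = 0 := by tauto
    linear_combination (D.shear D.r₀ - D.expansion D.r₀) * this
  · rw [thetaMinus_eq le_rfl h0, div_eq_zero_iff, mul_eq_zero] at h
    have : D.expansion D.r₀ - D.shear D.r₀ = 0 := by tauto
    linear_combination (-D.shear D.r₀ - D.expansion D.r₀) * this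

/-- The Misner–Sharp mass is nonnegative at the boundary or at the center. -/
theorem exists_misnerSharp_lower_bound (hn : 3 ≤ n) (hHor : D.OutermostHorizonOrNoBoundary) :
    ∃ L : ℝ → ℝ, (∀ᶠ r in 𝓝[>] D.r₀, L r ≤ misnerSharp n D.rho D.expansion D.shear r) ∧
      Tendsto L (𝓝[>] D.r₀) (𝓝 0) := by
  have hρc := (D.contDiffOn_rho hn).continuousOn
  rcases D.r₀_nonneg.eq_or_lt with h0 | h0
  · obtain ⟨i, j, hij⟩ := exists_ne hn
    -- At a center, dropping `1 + Y²` leaves `-½ ρⁿ⁻² X²`, which tends to `0` because `ρ` does and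
    -- `X` stays bounded. The ray component replaces `g₁₁`, whose value at `0` is not determined by
    -- the metric.
    refine ⟨fun r => -(D.rho r ^ (n - 2) * (derivWithin D.rho (Set.Ici D.r₀) r ^ 2 /
      rayComp D.g i i r) / 2), ?_, ?_⟩
    · filter_upwards [self_mem_nhdsWithin] with r hr
      have hr' : D.r₀ < r := hr
      have hr0 := D.r₀_nonneg.trans_lt hr'
      rw [D.rayComp_g_self i hr'.le hr0, misnerSharp, expansion, div_pow, D.sqrt_sq_g₁₁ hn hr']
      have hρ := D.rho_pos r hr'.le hr0
      have h1 : 0 ≤ D.rho r ^ (n - 2) * (1 + D.shear r ^ 2) := by positivity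
      linarith
    · have hc : ContinuousWithinAt (fun r => -(D.rho r ^ (n - 2) *
          (derivWithin D.rho (Set.Ici D.r₀) r ^ 2 / rayComp D.g i i r) / 2)) (Set.Ici D.r₀) D.r₀ :=
        ((((hρc.pow (n - 2)).mul ((((D.contDiffOn_rho hn).derivWithin (m := ∞) (uniqueDiffOn_Ici _)
          (by simp)).continuousOn.pow 2).div
          (contDiffOn_rayComp D.r₀_nonneg D.g_smooth i i).continuousOn
          fun r hr => (D.rayComp_g_pos i i hr).ne')).div_const 2).neg) D.r₀ Set.self_mem_Ici
      have h1 := (hc.mono Set.Ioi_subset_Ici_self).tendsto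
      rw [show D.rho D.r₀ = 0 by rw [← h0]; exact D.rho_zero h0.symm,
        zero_pow (by omega : n - 2 ≠ 0)] at h1
      simpa using h1
  · have hsub : Set.Ici D.r₀ ⊆ D.radii := fun r hr => ⟨hr, h0.trans_le hr⟩
    -- At a horizon `X² = Y²`; dropping the `1` leaves a bound that tends to `0`.
    refine ⟨fun r => D.rho r ^ (n - 2) * (D.shear r ^ 2 - D.expansion r ^ 2) / 2, ?_, ?_⟩
    · filter_upwards [self_mem_nhdsWithin] with r hr
      have hr' : D.r₀ < r := hr
      have hρ := D.rho_pos r hr'.le (D.r₀_nonneg.trans_lt hr')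
      rw [misnerSharp]
      have : 0 ≤ D.rho r ^ (n - 2) := by positivity
      linarith
    · have hc : ContinuousWithinAt (fun r => D.rho r ^ (n - 2) *
          (D.shear r ^ 2 - D.expansion r ^ 2) / 2) (Set.Ici D.r₀) D.r₀ :=
        (((hρc.pow (n - 2)).mul ((((D.contDiffOn_shear hn).continuousOn.mono hsub).pow 2).sub
          (((D.contDiffOn_expansion hn).continuousOn.mono hsub).pow 2))).div_const 2) D.r₀
          Set.self_mem_Ici
      have h1 := (hc.mono Set.Ioi_subset_Ici_self).tendsto
      rw [abs_shear_eq_of_horizon hn h0 hHor] at h1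
      simpa using h1

theorem strictMonoOn_rho (hn : 3 ≤ n) {ρ₀ C : ℝ} (h : D.AsymptoticallyFlat ρ₀ C)
    (hHor : D.OutermostHorizonOrNoBoundary) : StrictMonoOn D.rho (Set.Ioi D.r₀) := by
  refine strictMonoOn_of_deriv_pos (convex_Ioi _)
    (fun r hr => (D.hasDerivAt_rho hn hr).continuousAt.continuousWithinAt) fun r hr => ?_
  rw [interior_Ioi] at hr
  rw [(D.hasDerivAt_rho hn hr).deriv]
  exact mul_pos (Real.sqrt_pos.2 (D.g₁₁_pos hn (le_of_lt hr) (D.r₀_nonneg.trans_lt hr)))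
    ((abs_nonneg _).trans_lt (abs_shear_lt_expansion hn h hHor hr))

/-! ### The inner end of the Jang graph and the bound on the defect -/

/-- Identifies the weight in the Riccati inequality as the radial length density of `ḡ`. -/
theorem sqrt_div_sqrt_slope (hn : 3 ≤ n) (φ : ℝ → ℝ) {r : ℝ} (hr : D.r₀ < r) :
    √(D.g₁₁ r) / √(1 - D.slope φ r ^ 2) = √(D.g₁₁ r + deriv φ r ^ 2) := by
  have hg := D.g₁₁_pos hn hr.le (D.r₀_nonneg.trans_lt hr)
  rw [one_sub_slope_sq hg, Real.sqrt_div hg.le, div_div_eq_mul_div,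
    mul_div_cancel_left₀ _ (Real.sqrt_pos.2 hg).ne']

/-- The inner end of the Jang graph is far away compared to the area radius. -/
theorem exists_divergent_primitive (hn : 3 ≤ n) {ρ₀ C : ℝ} (h : D.AsymptoticallyFlat ρ₀ C)
    (hHor : D.OutermostHorizonOrNoBoundary) {f : Space n → ℝ} (hJ : D.IsJangSolution f)
    {φ : ℝ → ℝ} (hf : ∀ x ∈ D.inner, f x = φ ‖x‖)
    (hφ : ∀ r, D.r₀ < r → HasDerivAt φ (deriv φ r) r) :
    ∃ W w : ℝ → ℝ, (∀ᶠ r in 𝓝[>] D.r₀, HasDerivAt W (w r) r ∧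
      w r ≤ √(D.g₁₁ r) / √(1 - D.slope φ r ^ 2) * (((n : ℝ) - 1) / D.rho r)) ∧
      Tendsto W (𝓝[>] D.r₀) atBot := by
  have hn' : (3 : ℝ) ≤ n := by exact_mod_cast hn
  obtain ⟨i, j, hij⟩ := exists_ne hn
  rcases D.r₀_nonneg.eq_or_lt with h0 | h0
  · have hG := contDiffOn_rayComp D.r₀_nonneg D.g_smooth i i
    have hC := contDiffOn_rayComp D.r₀_nonneg D.g_smooth i j
    have hG0 := Real.sqrt_pos.2 (D.rayComp_g_pos i i le_rfl)
    have hG1 := ((hG.continuousOn.sqrt D.r₀ Set.self_mem_Ici).mono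
      Set.Ioi_subset_Ici_self).eventually (lt_mem_nhds (half_lt_self hG0))
    have hC1 := ((hC.continuousOn.sqrt D.r₀ Set.self_mem_Ici).mono
      Set.Ioi_subset_Ici_self).eventually (gt_mem_nhds (lt_add_one _))
    set l := √(rayComp D.g i i D.r₀) / 2
    set U := √(rayComp D.g i j D.r₀) + 1
    have hl : 0 < l := half_pos hG0
    have hU : 0 < U := by positivity
    -- Near a center the radial length density is at least `l` and `ρ ≤ U r`, so the weight
    -- dominates `l/(U r)`, whose primitive diverges.
    refine ⟨fun r => l / U * Real.log r, fun r => l / U * r⁻¹, ?_, ?_⟩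
    · filter_upwards [hG1, hC1, self_mem_nhdsWithin] with r hr1 hr2 hr
      have hr' : D.r₀ < r := hr
      have hr0 := D.r₀_nonneg.trans_lt hr'
      have hρ := D.rho_pos r hr'.le hr0
      refine ⟨(Real.hasDerivAt_log hr0.ne').const_mul _, ?_⟩
      rw [sqrt_div_sqrt_slope hn φ hr']
      rw [D.rayComp_g_self i hr'.le hr0] at hr1
      have h1 : l ≤ √(D.g₁₁ r + deriv φ r ^ 2) :=
        hr1.le.trans (Real.sqrt_le_sqrt (le_add_of_nonneg_right (sq_nonneg _)))
      have h2 : D.rho r ≤ U * r := by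
        rw [D.rho_eq hij hr'.le, mul_comm]
        exact mul_le_mul_of_nonneg_right hr2.le hr0.le
      have h3 : 1 / (U * r) ≤ ((n : ℝ) - 1) / D.rho r :=
        div_le_div₀ (by linarith) (by linarith) hρ h2
      calc l / U * r⁻¹ = l * (1 / (U * r)) := by field_simp
        _ ≤ _ := mul_le_mul h1 h3 (by positivity) (Real.sqrt_nonneg _)
    · rw [← h0]
      exact Real.tendsto_log_nhdsGT_zero.const_mul_atBot (div_pos hl hU)
  · have hρ1 := D.rho_pos (D.r₀ + 1) (by linarith) (by linarith)
    -- Near a horizon `ρ` is bounded by its value at `r₀ + 1`, and the length density is at least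
    -- `|φ'|`. So `∓c φ` is a primitive below the weight, and it tends to `-∞` because `φ → ±∞`.
    set c := ((n : ℝ) - 1) / D.rho (D.r₀ + 1) with hc
    have hc0 : 0 < c := div_pos (by linarith) hρ1
    have hle : ∀ᶠ r in 𝓝[>] D.r₀, D.r₀ < r ∧ c * |deriv φ r| ≤
        √(D.g₁₁ r) / √(1 - D.slope φ r ^ 2) * (((n : ℝ) - 1) / D.rho r) := by
      filter_upwards [Ioo_mem_nhdsGT (lt_add_one D.r₀)] with r hr
      refine ⟨hr.1, ?_⟩
      have hρ := D.rho_pos r hr.1.le (h0.trans hr.1)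
      rw [sqrt_div_sqrt_slope hn φ hr.1, mul_comm c]
      refine mul_le_mul (Real.abs_le_sqrt (le_add_of_nonneg_left
        (D.g₁₁_pos hn hr.1.le (h0.trans hr.1)).le)) ?_ hc0.le (Real.sqrt_nonneg _)
      exact div_le_div_of_nonneg_left (by linarith) hρ
        ((strictMonoOn_rho hn h hHor).monotoneOn hr.1 (lt_add_one D.r₀) hr.2.le)
    have hray : Tendsto (fun r : ℝ => (EuclideanSpace.single i r : Space n)) (𝓝[>] D.r₀)
        (comap norm (𝓝[>] D.r₀)) := by
      refine tendsto_comap_iff.2 (tendsto_id.congr' ?_)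
      filter_upwards [self_mem_nhdsWithin] with r hr
      exact (norm_single_of_nonneg i (h0.trans hr).le).symm
    have hfφ : ∀ᶠ r in 𝓝[>] D.r₀, f (EuclideanSpace.single i r) = φ r := by
      filter_upwards [self_mem_nhdsWithin] with r hr
      have he := norm_single_of_nonneg i (h0.trans hr).le
      rw [hf _ (InitialData.mem_inner_of_lt (by rwa [he])), he]
    rcases hJ.blowUp h0 with ⟨-, hblow⟩ | ⟨-, hblow⟩
    · refine ⟨fun r => -c * φ r, fun r => -c * deriv φ r, ?_,
        ((hblow.comp hray).congr' hfφ).const_mul_atTop_of_neg (neg_neg_of_pos hc0)⟩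
      filter_upwards [hle] with r hr
      refine ⟨(hφ r hr.1).const_mul _, le_trans ?_ hr.2⟩
      nlinarith [neg_abs_le (deriv φ r)]
    · refine ⟨fun r => c * φ r, fun r => c * deriv φ r, ?_,
        ((hblow.comp hray).congr' hfφ).const_mul_atBot hc0⟩
      filter_upwards [hle] with r hr
      refine ⟨(hφ r hr.1).const_mul _, le_trans ?_ hr.2⟩
      nlinarith [le_abs_self (deriv φ r)]

/-- The Jang defect is bounded by the ADM mass. -/
theorem sq_defect_le (hn : 3 ≤ n) {ρ₀ C : ℝ} (h : D.AsymptoticallyFlat ρ₀ C)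
    (hDEC : D.DominantEnergy) (hHor : D.OutermostHorizonOrNoBoundary) {m : ℝ}
    (hm : D.HasADMMass m) {f : Space n → ℝ} (hJ : D.IsJangSolution f)
    {φ : ℝ → ℝ} (hf : ∀ x ∈ D.inner, f x = φ ‖x‖) (hφ : ∀ r, D.r₀ < r →
      HasDerivAt φ (deriv φ r) r ∧ HasDerivAt (deriv φ) (deriv (deriv φ) r) r)
    {r : ℝ} (hr : D.r₀ < r) :
    (D.expansion r * D.slope φ r - D.shear r) ^ 2 ≤ min 1 (2 * m / D.rho r ^ (n - 2)) := by
  obtain ⟨μ, J, hc⟩ := D.exists_sphericalConstraints hn hDEC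
    fun r hr => abs_shear_lt_expansion hn h hHor hr
  obtain ⟨E, hE, rfl⟩ := HasADMMass.tendsto_energyFlux D hn hm
  have hM : ∀ r, D.r₀ < r → _ := fun r hr => hc.misnerSharp_mem_Icc hn
    (exists_misnerSharp_lower_bound hn hHor) (tendsto_misnerSharp hn h hE) hr
  have hode := jangODE hn hJ hf hφ
  obtain ⟨W, w, hW, hW'⟩ := exists_divergent_primitive hn h hHor hJ hf fun r hr => (hφ r hr).1
  have h1 := hc.boosted_le_one hn hode (fun r hr => (hM r hr).1) hW hW' hr
  have h2 := hc.defect_le hode hr h1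
  have hρ := D.rho_pos r hr.le (D.r₀_nonneg.trans_lt hr)
  have hY := abs_shear_lt_expansion hn h hHor hr
  refine le_min ?_ ?_
  · have : D.shear r ^ 2 ≤ D.expansion r ^ 2 := by
      rw [← sq_abs (D.shear r)]
      exact pow_le_pow_left₀ (abs_nonneg _) hY.le 2
    linarith
  · rw [le_div_iff₀ (by positivity)]
    have h3 := (hM r hr).2.trans (le_abs_self E)
    rw [misnerSharp] at h3
    have := mul_le_mul_of_nonneg_right h2 (by positivity : 0 ≤ D.rho r ^ (n - 2))
    linarith

end SphericalData

/-! ### Polar coordinates and exhaustions -/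

/-- Integration of radial functions in polar coordinates. -/
theorem lintegral_radial {n : ℕ} (hn : 3 ≤ n) {F : ℝ → ℝ≥0∞} (hF : Measurable F) :
    ∫⁻ x : Space n, F ‖x‖ = (volume : Measure (Space n)).toSphere Set.univ *
      ∫⁻ r in Set.Ioi (0 : ℝ), ENNReal.ofReal (r ^ (n - 1)) * F r := by
  have : Nonempty (Fin n) := ⟨⟨0, by omega⟩⟩
  have : Nontrivial (Space n) := inferInstance
  have hd : Module.finrank ℝ (Space n) = n := finrank_euclideanSpace_fin
  have h1 := (volume : Measure (Space n)).measurePreserving_homeomorphUnitSphereProd.lintegral_comp_emb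
    (Homeomorph.measurableEmbedding _) (fun z => F (z.2 : ℝ))
  simp only [homeomorphUnitSphereProd_apply_snd_coe] at h1
  calc ∫⁻ x : Space n, F ‖x‖ = ∫⁻ x in ({0}ᶜ : Set (Space n)), F ‖x‖ := by
        rw [restrict_compl_singleton]
    _ = ∫⁻ x : ({0}ᶜ : Set (Space n)), F ‖(x : Space n)‖
          ∂(volume.comap (Subtype.val : ({0}ᶜ : Set (Space n)) → Space n)) :=
        (lintegral_subtype_comap (measurableSet_singleton _).compl fun x => F ‖x‖).symm
    _ = ∫⁻ z, F (z.2 : ℝ) ∂(volume.toSphere.prod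
          (Measure.volumeIoiPow (Module.finrank ℝ (Space n) - 1))) := h1
    _ = ∫⁻ _ : Metric.sphere (0 : Space n) 1, ∫⁻ r : Set.Ioi (0 : ℝ), F r
          ∂(Measure.volumeIoiPow (Module.finrank ℝ (Space n) - 1)) ∂volume.toSphere :=
        lintegral_prod _ (hF.comp (measurable_subtype_coe.comp measurable_snd)).aemeasurable
    _ = _ := by
        rw [lintegral_const, mul_comm, Measure.volumeIoiPow,
          lintegral_withDensity_eq_lintegral_mul (g := fun r : Set.Ioi (0 : ℝ) => F r) _
            (by fun_prop) (hF.comp measurable_subtype_coe), hd]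
        congr 1
        exact lintegral_subtype_comap measurableSet_Ioi
          fun r => ENNReal.ofReal (r ^ (n - 1)) * F r

/-- A set of reals bounded by `b` has measure at most `K` if the intervals from its points to `b`
do. -/
theorem measure_le_of_forall_Icc (ν : Measure ℝ) {I : Set ℝ} {a b : ℝ} {K : ℝ≥0∞}
    (ha : ∀ r ∈ I, a ≤ r) (hb : ∀ r ∈ I, r ≤ b) (hK : ∀ r ∈ I, ν (Set.Icc r b) ≤ K) :
    ν I ≤ K := by
  rcases I.eq_empty_or_nonempty with rfl | hne
  · simp
  by_cases hmem : sInf I ∈ I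
  · exact (measure_mono (t := Set.Icc (sInf I) b) fun r hr => ⟨csInf_le ⟨a, ha⟩ hr, hb r hr⟩).trans (hK _ hmem)
  -- When the infimum is not attained, `I` is exhausted by intervals starting at points of `I` that
  -- decrease to it.
  obtain ⟨u, hu, hlim, huI⟩ := exists_seq_tendsto_sInf hne ⟨a, ha⟩
  have hsub : I ⊆ ⋃ k, Set.Icc (u k) b := by
    intro r hr
    have hlt : sInf I < r := (csInf_le ⟨a, ha⟩ hr).lt_of_ne fun h => hmem (h ▸ hr)
    obtain ⟨k, hk⟩ := (hlim.eventually (gt_mem_nhds hlt)).exists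
    exact Set.mem_iUnion.2 ⟨k, hk.le, hb r hr⟩
  have hmono : Monotone fun k => Set.Icc (u k) b := fun k l hkl => Set.Icc_subset_Icc_left (hu hkl)
  refine (measure_mono hsub).trans ?_
  rw [hmono.measure_iUnion]
  exact iSup_le fun k => hK _ (huI k)

/-! ### Radial length -/

namespace Riem

variable {n : ℕ}

/-- The radial part of a vector is bounded by its length in a radial metric. -/
theorem sq_mul_sum_nu_le {x : Space n} (hx : x ≠ 0) {N T : ℝ} (hT : 0 ≤ T) (w : Fin n → ℝ) :
    N * (∑ i, nu x i * w i) ^ 2 ≤ ∑ i, ∑ j, radMat N T x i j * w i * w j := by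
  have h1 : ∀ i, ∑ j, radMat N T x i j * w i * w j =
      (N - T) * (∑ j, nu x j * w j) * (nu x i * w i) + T * (w i * w i) := by
    intro i
    have : ∀ j, radMat N T x i j * w i * w j =
        N * (nu x i * w i) * (nu x j * w j) + T * w i * (tang x i j * w j) := fun j => by
      rw [radMat_apply]; ring
    simp_rw [this, Finset.sum_add_distrib, ← Finset.mul_sum, sum_tang_mul]
    ring
  simp_rw [h1, Finset.sum_add_distrib, ← Finset.mul_sum]
  have h2 : (∑ i, nu x i * w i) ^ 2 ≤ ∑ i, w i * w i := by
    refine (Finset.sum_mul_sq_le_sq_mul_sq _ _ _).trans_eq ?_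
    have h3 : ∑ i, nu x i ^ 2 = 1 := by simp_rw [sq, sum_nu_mul_nu hx]
    rw [h3, one_mul]
    simp_rw [sq]
  nlinarith [mul_le_mul_of_nonneg_left h2 hT]

/-- A curve with endpoints on the spheres of radii `a ≤ b` reaches the first of them a last
time. -/
theorem exists_last_time {γ : ℝ → Space n} (hγ : ContinuousOn γ (Set.Icc 0 1)) {a : ℝ}
    (h0 : ‖γ 0‖ = a) (h1 : a ≤ ‖γ 1‖) :
    ∃ t₀ ∈ Set.Icc (0 : ℝ) 1, ‖γ t₀‖ = a ∧ ∀ t ∈ Set.Icc t₀ 1, a ≤ ‖γ t‖ := by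
  have hK : IsCompact {t ∈ Set.Icc (0 : ℝ) 1 | ‖γ t‖ = a} := by
    have := (hγ.norm.preimage_isClosed_of_isClosed isClosed_Icc (isClosed_singleton (x := a)))
    exact isCompact_Icc.of_isClosed_subset this Set.inter_subset_left
  obtain ⟨t₀, ⟨ht₀, hta⟩, hmax⟩ := hK.exists_isGreatest ⟨0, ⟨le_rfl, zero_le_one⟩, h0⟩
  refine ⟨t₀, ht₀, hta, fun t ht => ?_⟩
  by_contra! hlt
  obtain ⟨z, hz, hza⟩ := intermediate_value_Icc ht.2
    (hγ.norm.mono fun y hy => ⟨ht₀.1.trans (ht.1.trans hy.1), hy.2⟩) ⟨hlt.le, h1⟩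
  have h2 : z ≤ t₀ := hmax ⟨⟨ht₀.1.trans (ht.1.trans hz.1), hz.2⟩, hza⟩
  have h3 : t = t₀ := le_antisymm (hz.1.trans h2) ht.1
  rw [h3, hta] at hlt
  exact lt_irrefl _ hlt

/-- The length of a curve in a radial metric is at least its radial length. -/
theorem lintegral_Icc_le_curveLength {G : TensorField n} {r₀ : ℝ} (hr₀ : 0 ≤ r₀) {σ T : ℝ → ℝ}
    (hσc : ContinuousOn σ (Set.Ioi r₀)) (hσ : ∀ r, r₀ < r → 0 ≤ σ r) (hT : ∀ r, r₀ < r → 0 ≤ T r)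
    (hG : ∀ x, r₀ < ‖x‖ → G x = radMat (σ ‖x‖ ^ 2) (T ‖x‖) x) {γ : ℝ → Space n}
    (hγ : ContDiffOn ℝ 1 γ (Set.Icc 0 1)) (h0 : r₀ < ‖γ 0‖) (h1 : ‖γ 0‖ ≤ ‖γ 1‖) :
    ∫⁻ r in Set.Icc ‖γ 0‖ ‖γ 1‖, ENNReal.ofReal (σ r) ≤ curveLength G γ := by
  -- A curve may run inward first, even through the origin. After `t₀` it stays at radius at least
  -- `‖γ 0‖ > r₀`, where the radial form of `G` applies.
  obtain ⟨t₀, ht₀, hta, hge⟩ := exists_last_time hγ.continuousOn rfl h1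
  have hpos : ∀ t ∈ Set.Icc t₀ 1, r₀ < ‖γ t‖ := fun t ht => h0.trans_le (hge t ht)
  have hsub : Set.Icc t₀ 1 ⊆ Set.Icc (0 : ℝ) 1 := Set.Icc_subset_Icc_left ht₀.1
  -- `S` is the radial length measured from the starting sphere. Along the curve `S(‖γ‖)` has
  -- derivative `q`, and `|q|` is at most the `G`-speed, so integrating gives the claim.
  set S : ℝ → ℝ := fun r => ∫ t in ‖γ 0‖..r, σ t with hS
  have hSd : ∀ r, r₀ < r → HasDerivAt S (σ r) r := by
    intro r hr
    have hsub' : Set.uIcc ‖γ 0‖ r ⊆ Set.Ioi r₀ := fun y hy => (lt_min h0 hr).trans_le hy.1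
    exact intervalIntegral.integral_hasDerivAt_right
      ((hσc.mono hsub').intervalIntegrable)
      (hσc.stronglyMeasurableAtFilter isOpen_Ioi r hr)
      (hσc.continuousAt (Ioi_mem_nhds hr))
  set d : ℝ → Space n := derivWithin γ (Set.Icc 0 1) with hd
  have hdc : ContinuousOn d (Set.Icc 0 1) :=
    hγ.continuousOn_derivWithin (uniqueDiffOn_Icc zero_lt_one) le_rfl
  set q : ℝ → ℝ := fun t => σ ‖γ t‖ * (inner ℝ (γ t) (d t) / ‖γ t‖) with hq
  have hnorm : ContinuousOn (fun t => ‖γ t‖) (Set.Icc t₀ 1) := hγ.continuousOn.norm.mono hsub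
  have hqc : ContinuousOn q (Set.Icc t₀ 1) :=
    (hσc.comp hnorm hpos).mul (((hγ.continuousOn.mono hsub).inner (𝕜 := ℝ) (hdc.mono hsub)).div hnorm
      fun t ht => (hr₀.trans_lt (hpos t ht)).ne')
  have hder : ∀ t ∈ Set.Ioo t₀ 1, HasDerivAt γ (d t) t := by
    intro t ht
    have hmem : Set.Icc (0 : ℝ) 1 ∈ 𝓝 t := Icc_mem_nhds (ht₀.1.trans_lt ht.1) ht.2
    have := ((hγ.differentiableOn one_ne_zero) t (mem_of_mem_nhds hmem)).differentiableAt hmem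
    rw [hd, derivWithin_of_mem_nhds hmem]
    exact this.hasDerivAt
  have hcomp : ∀ t ∈ Set.Ioo t₀ 1, HasDerivAt (fun t => S ‖γ t‖) (q t) t := by
    intro t ht
    have hp := hpos t (Set.Ioo_subset_Icc_self ht)
    have hn0 : ‖γ t‖ ≠ 0 := (hr₀.trans_lt hp).ne'
    have h2 := ((hder t ht).norm_sq.sqrt (pow_ne_zero 2 hn0))
    simp only [Real.sqrt_sq (norm_nonneg _)] at h2
    refine ((hSd _ hp).comp t h2).congr_deriv ?_
    rw [hq]
    field_simp
  have hint : IntervalIntegrable q volume t₀ 1 :=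
    ContinuousOn.intervalIntegrable (by rwa [Set.uIcc_of_le ht₀.2])
  have hFTC := intervalIntegral.integral_eq_sub_of_hasDerivAt_of_le ht₀.2
    (f := fun t => S ‖γ t‖) (fun t ht => ContinuousAt.comp_continuousWithinAt
      (f := fun t => ‖γ t‖) (hSd _ (hpos t ht)).continuousAt (hnorm t ht))
    hcomp hint
  rw [show S ‖γ t₀‖ = 0 by rw [hta, hS]; simp, sub_zero] at hFTC
  have hσi : IntegrableOn σ (Set.Ioc ‖γ 0‖ ‖γ 1‖) :=
    ((hσc.mono fun y hy => h0.trans_le hy.1).integrableOn_Icc).mono_set Set.Ioc_subset_Icc_self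
  have hstep : ∫⁻ r in Set.Icc ‖γ 0‖ ‖γ 1‖, ENNReal.ofReal (σ r) = ENNReal.ofReal (S ‖γ 1‖) := by
    simp only [hS]
    rw [Measure.restrict_congr_set Ioc_ae_eq_Icc.symm, intervalIntegral.integral_of_le h1]
    refine (ofReal_integral_eq_lintegral_ofReal hσi ?_).symm
    filter_upwards [ae_restrict_mem measurableSet_Ioc] with r hr using hσ r (h0.trans hr.1)
  rw [hstep, ← hFTC, intervalIntegral.integral_of_le ht₀.2]
  have hqi : IntegrableOn q (Set.Ioc t₀ 1) := hint.1
  calc ENNReal.ofReal (∫ t in Set.Ioc t₀ 1, q t)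
      ≤ ENNReal.ofReal (∫ t in Set.Ioc t₀ 1, |q t|) :=
        ENNReal.ofReal_le_ofReal (integral_mono hqi hqi.abs fun t => le_abs_self _)
    _ = ∫⁻ t in Set.Ioc t₀ 1, ENNReal.ofReal |q t| :=
        ofReal_integral_eq_lintegral_ofReal hqi.abs (.of_forall fun t => abs_nonneg _)
    -- The length uses `deriv γ`, which agrees with the one-sided derivative `d` only in the
    -- interior; the endpoints are null.
    _ = ∫⁻ t in Set.Ioo t₀ 1, ENNReal.ofReal |q t| := by
        rw [Measure.restrict_congr_set Ioo_ae_eq_Ioc]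
    _ ≤ ∫⁻ t in Set.Ioo t₀ 1, ENNReal.ofReal
          (√(∑ i, ∑ j, G (γ t) i j * (deriv γ t) i * (deriv γ t) j)) := by
        refine setLIntegral_mono' measurableSet_Ioo fun t ht => ENNReal.ofReal_le_ofReal ?_
        have hp := hpos t (Set.Ioo_subset_Icc_self ht)
        have hx0 : γ t ≠ 0 := norm_pos_iff.1 (hr₀.trans_lt hp)
        rw [(hder t ht).deriv, hG _ hp]
        refine Real.abs_le_sqrt (le_trans (le_of_eq ?_)
          (sq_mul_sum_nu_le hx0 (hT _ hp) (fun i => d t i)))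
        have : ∑ i, nu (γ t) i * d t i = inner ℝ (γ t) (d t) / ‖γ t‖ := by
          rw [PiLp.inner_apply, Finset.sum_div]
          refine Finset.sum_congr rfl fun i _ => ?_
          simp only [nu, RCLike.inner_apply, conj_trivial]
          ring
        rw [this, hq]
        ring
    _ ≤ curveLength G γ := lintegral_mono_set fun t ht => hsub (Set.Ioo_subset_Icc_self ht)

end Riem

/-! ### The estimate on the tubular region -/

/-- The pointwise bound behind the `L^p` estimate. -/
theorem rpow_defect_le {n : ℕ} (hn : 3 ≤ n) {p G ρ P m : ℝ} (hp₁ : 1 ≤ p) (hp₂ : p < 2)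
    (hρ : 0 < ρ) (hρP : ρ ≤ P) (hm : 0 ≤ m) (hG : G ^ 2 ≤ min 1 (2 * m / ρ ^ (n - 2))) :
    |G / ρ| ^ p * ρ ^ (n - 1) ≤ (2 * m) ^ ((2 - p) / 2) * P ^ ((2 + p * ((n : ℝ) - 4)) / 2) := by
  have hn' : (3 : ℝ) ≤ n := by exact_mod_cast hn
  have hG1 : |G| ≤ 1 := by
    rw [← sq_le_one_iff_abs_le_one]; exact hG.trans (min_le_left _ _)
  have h1 : |G| ^ p ≤ (2 * m / ρ ^ (n - 2)) ^ ((2 - p) / 2) := by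
    -- Lowering the exponent is allowed since `|G| ≤ 1` and `2 - p ≤ p`. The exponent `2 - p` is
    -- what makes the power of `ρ` below nonnegative in every dimension.
    calc |G| ^ p ≤ |G| ^ (2 - p) := by
          rcases (abs_nonneg G).eq_or_lt with h | h
          · rw [← h, Real.zero_rpow (by linarith), Real.zero_rpow (by linarith)]
          · exact Real.rpow_le_rpow_of_exponent_ge h hG1 (by linarith)
      _ = (G ^ 2) ^ ((2 - p) / 2) := by
          rw [← sq_abs, ← Real.rpow_natCast, ← Real.rpow_mul (abs_nonneg G)]
          congr 1
          push_cast
          ring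
      _ ≤ _ := Real.rpow_le_rpow (sq_nonneg G) (hG.trans (min_le_right _ _)) (by linarith)
  -- The worst case is `n = 3`, where the numerator is `2 - p`.
  have he : 0 ≤ (2 + p * ((n : ℝ) - 4)) / 2 := by nlinarith
  calc |G / ρ| ^ p * ρ ^ (n - 1)
      = |G| ^ p * (ρ ^ (n - 1) / ρ ^ p) := by
        rw [abs_div, abs_of_pos hρ, Real.div_rpow (abs_nonneg G) hρ.le]
        ring
    _ ≤ (2 * m / ρ ^ (n - 2)) ^ ((2 - p) / 2) * (ρ ^ (n - 1) / ρ ^ p) :=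
        mul_le_mul_of_nonneg_right h1 (by positivity)
    _ = (2 * m) ^ ((2 - p) / 2) * ρ ^ ((2 + p * ((n : ℝ) - 4)) / 2) := by
        rw [Real.div_rpow (by positivity) (by positivity), ← Real.rpow_natCast ρ (n - 1),
          ← Real.rpow_natCast ρ (n - 2), ← Real.rpow_mul hρ.le, div_mul_eq_mul_div, mul_div_assoc,
          ← Real.rpow_sub hρ, ← Real.rpow_sub hρ, Nat.cast_sub (by omega), Nat.cast_sub (by omega)]
        congr 2
        push_cast
        ring
    _ ≤ _ := mul_le_mul_of_nonneg_left (Real.rpow_le_rpow hρ.le hρP he) (by positivity)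

theorem areaRadius_pos {n : ℕ} (hn : 3 ≤ n) {A : ℝ} (hA : 0 < A) :
    0 < SphericalData.areaRadius n A :=
  Real.rpow_pos_of_pos (div_pos hA (sphereVolume_pos hn)) _

namespace SphericalData

variable {n : ℕ} {D : SphericalData n}

theorem lt_norm_of_mem_levelSphere (hn : 3 ≤ n) {A : ℝ} (hA : 0 < A) {b : Space n}
    (hb : b ∈ D.levelSphere A) : D.r₀ < ‖b‖ := by
  refine InitialData.lt_norm_of_mem_inner hb.1 fun hb0 => ?_
  have h0 : b ∈ D.carrier := interior_subset hb.1
  have h1 : D.r₀ ≤ ‖b‖ := h0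
  have h2 := hb.2
  rw [hb0, norm_zero] at h1 h2
  rw [D.rho_zero (le_antisymm h1 D.r₀_nonneg)] at h2
  exact (areaRadius_pos hn hA).ne h2

/-- The `L^p` norm of `h - k` on the tubular region is bounded in terms of the mass. -/
theorem lpNorm_secondFormDiff_le (hn : 3 ≤ n) {ρ₀ C : ℝ} (h : D.AsymptoticallyFlat ρ₀ C)
    (hDEC : D.DominantEnergy) (hHor : D.OutermostHorizonOrNoBoundary) {m : ℝ}
    (hm : D.HasADMMass m) {f : Space n → ℝ} (hJ : D.IsJangSolution f) {p A R : ℝ} (hp₁ : 1 ≤ p)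
    (hp₂ : p < 2) (hA : 0 < A) :
    Riem.lpNorm (D.jangMetric f) (D.secondFormDiff f) (D.tubularRegion f A R) p ≤
      (ENNReal.ofReal (√((n : ℝ) * ((n : ℝ) - 1)) ^ p * ((2 * m) ^ ((2 - p) / 2) *
        areaRadius n A ^ ((2 + p * ((n : ℝ) - 4)) / 2))) *
        ((volume : Measure (Space n)).toSphere Set.univ * ENNReal.ofReal R)) ^ (1 / p) := by
  have hm0 : 0 ≤ m := by
    obtain ⟨E, P, -, -, rfl⟩ := hm
    exact Real.sqrt_nonneg _
  have hn' : (3 : ℝ) ≤ n := by exact_mod_cast hn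
  obtain ⟨φ, hf, hφ⟩ := hJ.exists_radial hn
  set σ : ℝ → ℝ := fun r => √(D.g₁₁ r + deriv φ r ^ 2) with hσdef
  have hσpos : ∀ r, D.r₀ < r → 0 < D.g₁₁ r + deriv φ r ^ 2 := fun r hr => by
    have := D.g₁₁_pos hn hr.le (D.r₀_nonneg.trans_lt hr)
    positivity
  have hσc : ContinuousOn σ (Set.Ioi D.r₀) := fun r hr =>
    ((((hasDerivAt_of_contDiffOn_radii (D.contDiffOn_g₁₁ hn) hr).1.continuousAt).add
      ((hφ r hr).2.continuousAt.pow 2)).sqrt).continuousWithinAt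
  have hjm : ∀ x : Space n, D.r₀ < ‖x‖ →
      D.jangMetric f x = radMat (σ ‖x‖ ^ 2) ((D.rho ‖x‖ / ‖x‖) ^ 2) x := fun x hx => by
    rw [hσdef, Real.sq_sqrt (hσpos _ hx).le]
    exact jangMetric_eq hf (fun r hr => (hφ r hr).1) hx
  rw [Riem.lpNorm]
  refine ENNReal.rpow_le_rpow ?_ (by positivity)
  rcases (D.tubularRegion f A R).eq_empty_or_nonempty with hem | ⟨y, -, -, b, hb, -⟩
  · rw [hem]; simp
  have hbpos := lt_norm_of_mem_levelSphere hn hA hb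
  have hmono := strictMonoOn_rho hn h hHor
  -- `I` contains the radii of all points of the tubular region other than the origin. It is an
  -- interval, hence measurable.
  set I : Set ℝ := {r | D.r₀ < r ∧ r ≤ ‖b‖ ∧
    ∫⁻ t in Set.Icc r ‖b‖, ENNReal.ofReal (σ t) ≤ ENNReal.ofReal R} with hI
  have hIm : MeasurableSet I := by
    refine Set.OrdConnected.measurableSet ⟨fun r hr s hs t ht => ⟨hr.1.trans_le ht.1,
      ht.2.trans hs.2.1, (lintegral_mono_set (Set.Icc_subset_Icc_left ht.1)).trans hr.2.2⟩⟩
  have hregion : ∀ x ∈ D.tubularRegion f A R, x ≠ 0 → ‖x‖ ∈ I := by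
    rintro x ⟨⟨hx, hxA⟩, -, b', hb', hdist⟩ hx0
    have hxpos := InitialData.lt_norm_of_mem_inner hx hx0
    have hxb : ‖x‖ ≤ ‖b‖ := (hmono.le_iff_le hxpos hbpos).1 (hb.2 ▸ hxA)
    refine ⟨hxpos, hxb, ?_⟩
    have hb'0 : D.rho ‖b'‖ = D.rho ‖b‖ := hb'.2.trans hb.2.symm
    have hb'pos := lt_norm_of_mem_levelSphere hn hA hb'
    -- `ρ` is injective outside `r₀`, so `Σ_A` is a single coordinate sphere and one point `b`
    -- serves for the whole tube.
    have hbb : ‖b'‖ = ‖b‖ := hmono.injOn hb'pos hbpos hb'0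
    rw [Riem.dist] at hdist
    simp only [iInf_lt_iff] at hdist
    obtain ⟨γ, hγ, hγU, hγ0, hγ1, hlen⟩ := hdist
    have := lintegral_Icc_le_curveLength D.r₀_nonneg hσc (fun r _ => Real.sqrt_nonneg _)
      (T := fun r => (D.rho r / r) ^ 2) (fun r _ => sq_nonneg _) hjm hγ (by rwa [hγ0])
      (by rwa [hγ0, hγ1, hbb])
    rw [hγ0, hγ1, hbb] at this
    exact this.trans hlen.le
  set K := √((n : ℝ) * ((n : ℝ) - 1)) ^ p * ((2 * m) ^ ((2 - p) / 2) *
    areaRadius n A ^ ((2 + p * ((n : ℝ) - 4)) / 2)) with hK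
  have hK0 : 0 ≤ K := by
    have := (areaRadius_pos hn hA).le
    positivity
  -- The factor `1/rⁿ⁻¹`, coming from the Cartesian volume density of `ḡ`, cancels the Jacobian of
  -- polar coordinates and leaves `∫ σ dr` over `I`.
  set F : ℝ → ℝ≥0∞ := I.indicator fun r => ENNReal.ofReal (σ r / r ^ (n - 1)) with hF
  have hIsub : I ⊆ Set.Ioi D.r₀ := fun r hr => hr.1
  have hFm : Measurable F := by
    have h1 : Measurable (I.piecewise (fun r => σ r / r ^ (n - 1)) (fun _ => (0 : ℝ))) :=
      ContinuousOn.measurable_piecewise ((hσc.mono hIsub).div (continuous_pow _).continuousOn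
        fun r hr => (pow_pos (D.r₀_nonneg.trans_lt hr.1) _).ne') continuousOn_const hIm
    convert ENNReal.measurable_ofReal.comp h1 using 1
    ext r
    by_cases hr : r ∈ I <;> simp [hF, hr]
  have hpt : ∀ x : Space n, ‖x‖ ∈ I →
      ENNReal.ofReal (√(normSq (D.jangMetric f) (D.secondFormDiff f) x)) ^ p *
        ENNReal.ofReal (volDensity (D.jangMetric f) x) ≤ ENNReal.ofReal K * F ‖x‖ := by
    intro x hxI
    have hr := hxI.1
    have hr0 := D.r₀_nonneg.trans_lt hr
    have hx0 : x ≠ 0 := norm_pos_iff.1 hr0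
    have hxA : D.rho ‖x‖ ≤ areaRadius n A :=
      (hmono.monotoneOn hr hbpos hxI.2.1).trans_eq hb.2
    have hρ := D.rho_pos _ hr.le hr0
    have hσ0 : 0 < σ ‖x‖ := Real.sqrt_pos.2 (hσpos _ hr)
    rw [hF, Set.indicator_of_mem hxI, normSq_secondFormDiff hn hJ hf hφ hr,
      volDensity_radMat hx0 (by omega) (pow_ne_zero 2 (div_pos hρ hr0).ne') (hjm x hr),
      ENNReal.ofReal_rpow_of_nonneg (Real.sqrt_nonneg _) (by linarith),
      ← ENNReal.ofReal_mul (by positivity), ← ENNReal.ofReal_mul hK0]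
    refine ENNReal.ofReal_le_ofReal ?_
    set b := D.expansion ‖x‖ * D.slope φ ‖x‖ - D.shear ‖x‖ with hbdef
    have hdet : √(σ ‖x‖ ^ 2 * ((D.rho ‖x‖ / ‖x‖) ^ 2) ^ (n - 1)) =
        D.rho ‖x‖ ^ (n - 1) * (σ ‖x‖ / ‖x‖ ^ (n - 1)) := by
      rw [← pow_mul, mul_comm 2, pow_mul, ← mul_pow, Real.sqrt_sq (by positivity), div_pow]
      ring
    rw [hdet, Real.sqrt_mul' _ (sq_nonneg _), Real.sqrt_sq_eq_abs,
      Real.mul_rpow (Real.sqrt_nonneg _) (abs_nonneg _)]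
    have hb := rpow_defect_le hn hp₁ hp₂ hρ hxA hm0 (sq_defect_le hn h hDEC hHor hm hJ hf hφ hr)
    have h2 : 0 ≤ √((n : ℝ) * ((n : ℝ) - 1)) ^ p := by positivity
    have h3 : 0 ≤ σ ‖x‖ / ‖x‖ ^ (n - 1) := by positivity
    calc √((n : ℝ) * ((n : ℝ) - 1)) ^ p * |b / D.rho ‖x‖| ^ p *
          (D.rho ‖x‖ ^ (n - 1) * (σ ‖x‖ / ‖x‖ ^ (n - 1)))
        = √((n : ℝ) * ((n : ℝ) - 1)) ^ p * (|b / D.rho ‖x‖| ^ p * D.rho ‖x‖ ^ (n - 1)) *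
          (σ ‖x‖ / ‖x‖ ^ (n - 1)) := by ring
      _ ≤ _ := mul_le_mul_of_nonneg_right (mul_le_mul_of_nonneg_left hb h2) h3
  have hall : ∀ᵐ x : Space n, x ≠ 0 := by
    have : Nonempty (Fin n) := ⟨⟨0, by omega⟩⟩
    exact compl_mem_ae_iff.2 (measure_singleton _)
  calc ∫⁻ x in D.tubularRegion f A R,
        ENNReal.ofReal (√(normSq (D.jangMetric f) (D.secondFormDiff f) x)) ^ p *
          ENNReal.ofReal (volDensity (D.jangMetric f) x)
      -- Without boundary the origin may belong to the region; it is a null set and carries no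
      -- bound.
      ≤ ∫⁻ x in insert (0 : Space n) (norm ⁻¹' I),
          ENNReal.ofReal (√(normSq (D.jangMetric f) (D.secondFormDiff f) x)) ^ p *
            ENNReal.ofReal (volDensity (D.jangMetric f) x) :=
        lintegral_mono_set fun x hx => or_iff_not_imp_left.2 (hregion x hx)
    _ ≤ ∫⁻ x in insert (0 : Space n) (norm ⁻¹' I), ENNReal.ofReal K * F ‖x‖ := by
        refine setLIntegral_mono_ae' ((measurable_norm hIm).insert 0) ?_
        filter_upwards [hall] with x hx0 hx using hpt x (hx.resolve_left hx0)
    _ ≤ ∫⁻ x : Space n, ENNReal.ofReal K * F ‖x‖ := setLIntegral_le_lintegral _ _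
    _ = ENNReal.ofReal K * ∫⁻ x : Space n, F ‖x‖ :=
        lintegral_const_mul _ (hFm.comp measurable_norm)
    _ ≤ _ := by
        refine mul_le_mul_right ?_ _
        rw [lintegral_radial hn hFm]
        refine mul_le_mul_right ?_ _
        calc ∫⁻ r in Set.Ioi (0 : ℝ), ENNReal.ofReal (r ^ (n - 1)) * F r
            ≤ ∫⁻ r in Set.Ioi (0 : ℝ), I.indicator (fun r => ENNReal.ofReal (σ r)) r := by
              refine lintegral_mono fun r => ?_
              by_cases hr : r ∈ I
              · have hr0 := D.r₀_nonneg.trans_lt hr.1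
                rw [hF, Set.indicator_of_mem hr, Set.indicator_of_mem hr,
                  ← ENNReal.ofReal_mul (by positivity)]
                refine le_of_eq (congrArg _ ?_)
                field_simp
              · simp [hF, hr]
          _ ≤ ∫⁻ r, I.indicator (fun r => ENNReal.ofReal (σ r)) r := setLIntegral_le_lintegral _ _
          _ = ∫⁻ r in I, ENNReal.ofReal (σ r) := lintegral_indicator hIm _
          _ = volume.withDensity (fun r => ENNReal.ofReal (σ r)) I := (withDensity_apply _ hIm).symm
          _ ≤ ENNReal.ofReal R := by
              refine measure_le_of_forall_Icc _ (a := D.r₀) (b := ‖b‖) (fun r hr => hr.1.le)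
                (fun r hr => hr.2.1) fun r hr => ?_
              rw [withDensity_apply _ measurableSet_Icc]
              exact hr.2.2

end SphericalData

end

/-! ### Passage to the limit -/

theorem mainTheorem3 (n : ℕ) (hn : 3 ≤ n)
    (D : ℕ → SphericalData n) (f : ℕ → Space n → ℝ) (m : ℕ → ℝ) (ρ₀ C B : ℝ)
    (hAF : ∀ j, (D j).AsymptoticallyFlat ρ₀ C)
    (hDEC : ∀ j, (D j).DominantEnergy)
    (hHor : ∀ j, (D j).OutermostHorizonOrNoBoundary)
    (hk : ∀ j, Riem.lpNorm (D j).g (D j).k (D j).carrier 2 ≤ ENNReal.ofReal B)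
    (hm : ∀ j, (D j).HasADMMass (m j))
    (hm_lim : Tendsto m atTop (𝓝 0))
    (hf : ∀ j, (D j).IsJangSolution (f j))
    (p : ℝ) (hp₁ : 1 ≤ p) (hp₂ : p < 2) (A R : ℝ) (hA : 0 < A) (hR : 0 < R) :
    Tendsto (fun j => Riem.lpNorm ((D j).jangMetric (f j)) ((D j).secondFormDiff (f j))
      ((D j).tubularRegion (f j) A R) p) atTop (𝓝 0) := by
  refine tendsto_of_tendsto_of_tendsto_of_le_of_le tendsto_const_nhds ?_ (fun _ => zero_le)
    (fun j => SphericalData.lpNorm_secondFormDiff_le hn (hAF j) (hDEC j) (hHor j) (hm j) (hf j)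
      hp₁ hp₂ hA)
  -- The bound depends on `j` only through `m j`, which enters with the positive exponent `(2 -
  -- p)/2`.
  have h1 : Tendsto (fun j => √((n : ℝ) * ((n : ℝ) - 1)) ^ p * ((2 * m j) ^ ((2 - p) / 2) *
      SphericalData.areaRadius n A ^ ((2 + p * ((n : ℝ) - 4)) / 2))) atTop (𝓝 0) := by
    have h2 := (((hm_lim.const_mul 2).rpow_const (p := (2 - p) / 2)
      (Or.inr (by linarith))).mul_const
      (SphericalData.areaRadius n A ^ ((2 + p * ((n : ℝ) - 4)) / 2))).const_mul
      (√((n : ℝ) * ((n : ℝ) - 1)) ^ p)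
    rwa [mul_zero, Real.zero_rpow (by linarith), zero_mul, mul_zero] at h2
  have h3 := ENNReal.Tendsto.mul_const (b := (volume : Measure (Space n)).toSphere Set.univ *
    ENNReal.ofReal R) (ENNReal.tendsto_ofReal h1)
    (Or.inr (ENNReal.mul_ne_top (measure_ne_top _ _) ENNReal.ofReal_ne_top))
  have h4 := (ENNReal.continuous_rpow_const (y := 1 / p)).continuousAt.tendsto.comp h3
  rwa [ENNReal.ofReal_zero, zero_mul, ENNReal.zero_rpow_of_pos (by positivity)] at h4
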